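/- Let $M$ be a compact complex manifold without boundary, of complex dimension $n\ge 2$, let $\omega_0$ be a Hermitian metric on $M$ and let $\alpha$ be a Gauduchon metric on $M$, i.e. a Hermitian metric with $\partial\bar\partial(\alpha^{n-1})=0$. All metrics are smooth, and a Hermitian metric is identified with its fundamental form $\omega=\sqrt{-1}\sum_{i,j} g_{i\bar j}\,dz^i\wedge d\bar z^j$. Write $\mathrm{Ric}(\omega)=-\sqrt{-1}\,\partial\bar\partial\log\det(g_{i\bar j})$ for the Chern-Ricci form. For a Hermitian metric $\omega$ and $s\ge 0$ put $$\Phi_s(\omega):=\omega_0^{n-1}-s(n-1)\Big(\mathrm{Ric}(\omega)\wedge\alpha^{n-2}-\mathrm{Re}\Big(\sqrt{-1}\,\partial\log\frac{\omega^n}{\alpha^n}\wedge\bar\partial(\alpha^{n-2})\Big)\Big),$$ and say that $\omega$ solves the Gauduchon continuity equation at $s$ if $$\omega^{n-1}=\Phi_s(\omega)>0,$$ where a real $(n-1,n-1)$ form is $>0$ if its coefficient matrix, with respect to the forms $(\sqrt{-1})^{n-1}(-1)^{\frac{n(n+1)}2+i+j+1}dz^1\wedge\cdots\widehat{dz^i}\cdots\wedge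 dz^n\wedge d\bar z^1\wedge\cdots\widehat{d\bar z^j}\cdots\wedge d\bar z^n$, is positive definite Hermitian at every point. Let $$T:=\sup\Big\{s\ge 0:\ \exists\,\varphi\in C^\infty(M,\mathbb R)\ \text{with}\ \Phi_s(\omega_0)+\sqrt{-1}\,\partial\bar\partial\varphi\wedge\alpha^{n-2}+\mathrm{Re}\big(\sqrt{-1}\,\partial\varphi\wedge\bar\partial(\alpha^{n-2})\big)>0\Big\}\in[0,+\infty].$$ If $s\in[0,T)$ and $\omega$, $\omega'$ are two Hermitian metrics on $M$ that both solve the Gauduchon continuity equation at this $s$, then $\omega'=\omega$. -/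

import Mathlib

open scoped Manifold ContDiff ComplexOrder

noncomputable section

namespace GauduchonContinuity

/-- The model space `ℂⁿ`. -/
abbrev Cn (n : ℕ) : Type := EuclideanSpace ℂ (Fin n)

/-! ### Complex valued exterior forms on `ℂⁿ`, viewed as a real vector space -/

/-- Complexified cotangent space: the real-linear maps `ℂⁿ → ℂ`. -/
abbrev Covec (n : ℕ) : Type := Cn n →ₗ[ℝ] ℂ

/-- Complex valued exterior forms (of all degrees) at a point; the multiplication is the wedge
product. As the tangent space at every point of a manifold modelled on `ℂⁿ` is, in Mathlib, the
space `ℂⁿ` (through the preferred chart at the point), this is also the exterior algebra of the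
complexified cotangent space at a point of the manifold. -/
abbrev Form (n : ℕ) : Type := ExteriorAlgebra ℂ (Covec n)

/-- The complex 1-form `dzⁱ`. -/
def dz {n : ℕ} (i : Fin n) : Covec n :=
  ((EuclideanSpace.proj i : Cn n →L[ℂ] ℂ) : Cn n →ₗ[ℂ] ℂ).restrictScalars ℝ

/-- Complex conjugation of covectors. -/
def conjCovec {n : ℕ} (f : Covec n) : Covec n := Complex.conjAe.toLinearMap ∘ₗ f

/-- The complex 1-form `dz̄ⁱ`. -/
def dzbar {n : ℕ} (i : Fin n) : Covec n := conjCovec (dz i)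

/-- `1`-covectors as exterior forms. -/
def oneForm {n : ℕ} (f : Covec n) : Form n := ExteriorAlgebra.ι ℂ f

/-- Functions' values as exterior forms of degree `0`. -/
def zeroForm {n : ℕ} (c : ℂ) : Form n := algebraMap ℂ (Form n) c

/-- The ring `Form n` with the conjugate `ℂ`-algebra structure; only used to define complex
conjugation of forms by the universal property of the exterior algebra. -/
def ConjForm (n : ℕ) : Type := Form n

instance (n : ℕ) : Ring (ConjForm n) := inferInstanceAs (Ring (Form n))

instance (n : ℕ) : Algebra ℂ (ConjForm n) :=
  RingHom.toAlgebra' ((algebraMap ℂ (Form n)).comp (starRingEnd ℂ))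
    (fun c x => Algebra.commutes (starRingEnd ℂ c) (show Form n from x))

/-- The map `f ↦ f̄` on covectors, linear for the conjugate structure. -/
def conjCovecLinear (n : ℕ) : Covec n →ₗ[ℂ] ConjForm n where
  toFun f := oneForm (conjCovec f)
  map_add' f g := by
    have h : conjCovec (f + g) = conjCovec f + conjCovec g := by
      ext v; simp [conjCovec]
    rw [h]
    exact map_add (ExteriorAlgebra.ι ℂ) _ _
  map_smul' c f := by
    have h : conjCovec (c • f) = (starRingEnd ℂ c) • conjCovec f := by
      ext v; simp [conjCovec]
    have h' : oneForm (conjCovec (c • f)) =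
        algebraMap ℂ (Form n) (starRingEnd ℂ c) * oneForm (conjCovec f) := by
      rw [h, ← Algebra.smul_def]
      exact map_smul (ExteriorAlgebra.ι ℂ) (starRingEnd ℂ c) (conjCovec f)
    exact h'

/-- Complex conjugation of exterior forms: the conjugate-linear ring homomorphism that is
`f ↦ f̄` on covectors. -/
def conjForm (n : ℕ) : Form n →+* Form n :=
  (ExteriorAlgebra.lift ℂ ⟨conjCovecLinear n,
    fun f => ExteriorAlgebra.ι_sq_zero (conjCovec f)⟩ : Form n →ₐ[ℂ] ConjForm n).toRingHom

/-- Real part of an exterior form. -/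
def reForm {n : ℕ} (ψ : Form n) : Form n := (1 / 2 : ℂ) • (ψ + conjForm n ψ)

/-- Pull-back of exterior forms under a real-linear map. -/
def pullback {n : ℕ} (L : Cn n →ₗ[ℝ] Cn n) : Form n →ₐ[ℂ] Form n :=
  ExteriorAlgebra.map (LinearMap.lcomp ℂ ℂ L)

/-! ### The operators `∂` and `∂̄` on forms on open subsets of `ℂⁿ` -/

/-- A basis of the space of exterior forms at a point. -/
def formBasis (n : ℕ) :
    Module.Basis (Finset (Fin (Module.finrank ℂ (Covec n)))) ℂ (Form n) :=
  (Module.finBasis ℂ (Covec n)).ExteriorAlgebra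

/-- The derivative at `y` in direction `v` of a form, taken coefficient by coefficient with respect
to a constant basis. -/
def dirDeriv {n : ℕ} (F : Cn n → Form n) (y v : Cn n) : Form n :=
  ∑ k, (fderiv ℝ (fun z => (formBasis n).repr (F z) k) y v) • formBasis n k

/-- The `i`-th standard vector `∂/∂xⁱ` of `ℂⁿ`; `∂/∂yⁱ` is `Complex.I • stdVec i`. -/
def stdVec {n : ℕ} (i : Fin n) : Cn n := EuclideanSpace.single i (1 : ℂ)

/-- `∂F/∂zⁱ = (∂F/∂xⁱ - √-1 ∂F/∂yⁱ) / 2`. -/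
def partialZ {n : ℕ} (i : Fin n) (F : Cn n → Form n) (y : Cn n) : Form n :=
  (1 / 2 : ℂ) • (dirDeriv F y (stdVec i) - Complex.I • dirDeriv F y (Complex.I • stdVec i))

/-- `∂F/∂z̄ⁱ = (∂F/∂xⁱ + √-1 ∂F/∂yⁱ) / 2`. -/
def partialZbar {n : ℕ} (i : Fin n) (F : Cn n → Form n) (y : Cn n) : Form n :=
  (1 / 2 : ℂ) • (dirDeriv F y (stdVec i) + Complex.I • dirDeriv F y (Complex.I • stdVec i))

/-- `∂F = ∑ᵢ dzⁱ ∧ ∂F/∂zⁱ` on `ℂⁿ`. -/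
def delLocal {n : ℕ} (F : Cn n → Form n) (y : Cn n) : Form n :=
  ∑ i, oneForm (dz i) * partialZ i F y

/-- `∂̄F = ∑ᵢ dz̄ⁱ ∧ ∂F/∂z̄ⁱ` on `ℂⁿ`. -/
def delbarLocal {n : ℕ} (F : Cn n → Form n) (y : Cn n) : Form n :=
  ∑ i, oneForm (dzbar i) * partialZbar i F y

/-! ### Forms and Hermitian metrics on a complex manifold -/

/-- A complex manifold is in particular a smooth real manifold. -/
instance realManifold (n : ℕ) (M : Type*) [TopologicalSpace M] [ChartedSpace (Cn n) M]
    [IsManifold 𝓘(ℂ, Cn n) ω M] : IsManifold 𝓘(ℝ, Cn n) ∞ M := by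
  apply isManifold_of_contDiffOn
  intro e e' he he'
  have h := (contDiffGroupoid ω 𝓘(ℂ, Cn n)).compatible he he'
  rw [contDiffGroupoid, mem_groupoid_of_pregroupoid] at h
  have h1 : ContDiffOn ℂ ω (𝓘(ℂ, Cn n) ∘ e.symm ≫ₕ e' ∘ 𝓘(ℂ, Cn n).symm)
    (𝓘(ℂ, Cn n).symm ⁻¹' (e.symm ≫ₕ e').source ∩ Set.range 𝓘(ℂ, Cn n)) := h.1
  exact (h1.restrict_scalars ℝ).of_le le_top

section Manifold

variable {n : ℕ} {M : Type*} [TopologicalSpace M] [ChartedSpace (Cn n) M]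

/-- The complex structure `J` on the tangent space at `x`. -/
def J (x : M) (v : TangentSpace 𝓘(ℝ, Cn n) x) : TangentSpace 𝓘(ℝ, Cn n) x :=
  (Complex.I • (show Cn n from v) : Cn n)

/-- The differential at `y` of the inverse of the preferred chart at `x₀`. -/
def chartInvDeriv (x₀ : M) (y : Cn n) :
    Cn n →L[ℝ] TangentSpace 𝓘(ℝ, Cn n) ((chartAt (Cn n) x₀).symm y) :=
  mfderiv 𝓘(ℝ, Cn n) 𝓘(ℝ, Cn n) (chartAt (Cn n) x₀).symm y

/-- The expression of a form on `M` in the preferred chart at `x₀`: its pull-back to `ℂⁿ`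
under the inverse of the chart (meaningful on the target of the chart). -/
def inChart (η : M → Form n) (x₀ : M) (y : Cn n) : Form n :=
  pullback (chartInvDeriv x₀ y : Cn n →L[ℝ] Cn n).toLinearMap (η ((chartAt (Cn n) x₀).symm y))

/-- The operator `∂` on forms on `M`, computed at each point in the preferred chart there. -/
def del (η : M → Form n) (x : M) : Form n :=
  delLocal (inChart η x) (chartAt (Cn n) x x)

/-- The operator `∂̄` on forms on `M`, computed at each point in the preferred chart there. -/
def delbar (η : M → Form n) (x : M) : Form n :=
  delbarLocal (inChart η x) (chartAt (Cn n) x x)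

/-- A real function as a form of degree `0` on `M`. -/
def funForm (f : M → ℝ) (x : M) : Form n := zeroForm (f x : ℂ)

/-- A real form `ψ` of bidegree `(n-1,n-1)` at a point is strictly positive: the matrix `P` of its
coefficients with respect to the forms
`(√-1)ⁿ⁻¹ (-1)^(n(n+1)/2 + i + j + 1) dz¹∧⋯∧(omit dzⁱ)∧⋯∧dzⁿ∧dz̄¹∧⋯∧(omit dz̄ʲ)∧⋯∧dz̄ⁿ`
is a positive definite Hermitian matrix. (Indices here start at `0` instead of `1`, which does not
change the parity of `i + j`.) -/
def StrictlyPositive (ψ : Form n) : Prop :=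
  ∃ P : Matrix (Fin n) (Fin n) ℂ, P.PosDef ∧
    ψ = Complex.I ^ (n - 1) • ∑ i : Fin n, ∑ j : Fin n,
      ((-1 : ℂ) ^ (n * (n + 1) / 2 + (i : ℕ) + (j : ℕ) + 1) * P i j) •
        ((((List.finRange n).filter (fun k => k ≠ i)).map (fun k => oneForm (dz k))).prod *
          (((List.finRange n).filter (fun k => k ≠ j)).map (fun k => oneForm (dzbar k))).prod)

/-- The ratio `A / B` of two real forms of top degree, i.e. the real number `c` with `A = c B`. -/
def topRatio (A B : Form n) : ℝ :=
  open Classical in if h : ∃ c : ℝ, A = (c : ℂ) • B then h.choose else 0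

variable [IsManifold 𝓘(ℂ, Cn n) ω M]

variable (n M) in
/-- A Hermitian metric: a smooth Riemannian metric `g` with `g(JX, JY) = g(X, Y)`. -/
structure HermitianMetric extends
    Bundle.ContMDiffRiemannianMetric 𝓘(ℝ, Cn n) ∞ (Cn n)
      (fun x : M => TangentSpace 𝓘(ℝ, Cn n) x) where
  inner_J : ∀ (x : M) (v w : TangentSpace 𝓘(ℝ, Cn n) x),
    inner x (J x v) (J x w) = inner x v w

namespace HermitianMetric

/-- The matrix `g_{i j̄} = (g(∂/∂xⁱ, ∂/∂xʲ) + √-1 g(∂/∂xⁱ, ∂/∂yʲ)) / 2`, with respect to the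
coordinates of the preferred chart at `x₀`, at the point with coordinates `y`. -/
def localMatrix (g : HermitianMetric n M) (x₀ : M) (y : Cn n) : Matrix (Fin n) (Fin n) ℂ :=
  fun i j =>
    let B := g.inner ((chartAt (Cn n) x₀).symm y)
    let D := chartInvDeriv x₀ y
    (1 / 2 : ℂ) * ((B (D (stdVec i)) (D (stdVec j)) : ℝ) +
      Complex.I * (B (D (stdVec i)) (D (Complex.I • stdVec j)) : ℝ))

/-- The fundamental form `ω = √-1 ∑ g_{i j̄} dzⁱ ∧ dz̄ʲ`, equivalently `ω(X, Y) = g(JX, Y)`,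
in the coordinates of the preferred chart at the point. -/
def form (g : HermitianMetric n M) (x : M) : Form n :=
  Complex.I • ∑ i, ∑ j, g.localMatrix x (chartAt (Cn n) x x) i j •
    (oneForm (dz i) * oneForm (dzbar j))

/-- The Chern-Ricci form `Ric(ω) = -√-1 ∂∂̄ log det (g_{i j̄})`. -/
def chernRicci (g : HermitianMetric n M) (x : M) : Form n :=
  -(Complex.I • delLocal (delbarLocal
    (fun y => zeroForm ((Real.log (g.localMatrix x y).det.re : ℝ) : ℂ))) (chartAt (Cn n) x x))

/-- `log (ωⁿ / αⁿ)`. -/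
def logRatio (g α : HermitianMetric n M) (x : M) : ℝ :=
  Real.log (topRatio (g.form x ^ n) (α.form x ^ n))

/-- `α` is a Gauduchon metric: `∂∂̄ αⁿ⁻¹ = 0`. -/
def IsGauduchon (α : HermitianMetric n M) : Prop :=
  ∀ x : M, del (delbar (fun x' => α.form x' ^ (n - 1))) x = 0

/-- The form
`ω₀ⁿ⁻¹ - s (n-1) (Ric(ω) ∧ αⁿ⁻² - Re(√-1 ∂ log(ωⁿ/αⁿ) ∧ ∂̄(αⁿ⁻²)))`. -/
def continuityForm (ω₀ α g : HermitianMetric n M) (s : ℝ) (x : M) : Form n :=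
  ω₀.form x ^ (n - 1) - ((s * ((n : ℝ) - 1) : ℝ) : ℂ) •
    (g.chernRicci x * α.form x ^ (n - 2) -
      reForm (Complex.I • (del (funForm (g.logRatio α)) x *
        delbar (fun x' => α.form x' ^ (n - 2)) x)))

/-- `ω` solves the continuity equation starting at `ω₀`, with background metric `α`, at `s`. -/
def SolvesContinuityEquation (ω₀ α g : HermitianMetric n M) (s : ℝ) : Prop :=
  ∀ x : M, g.form x ^ (n - 1) = continuityForm ω₀ α g s x ∧
    StrictlyPositive (continuityForm ω₀ α g s x)

/-- The set of all `s ≥ 0` for which there is `φ ∈ C^∞(M, ℝ)` with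
`Φ_s + √-1 ∂∂̄φ ∧ αⁿ⁻² + Re(√-1 ∂φ ∧ ∂̄(αⁿ⁻²)) > 0`, where `Φ_s` is the right-hand side of the
continuity equation with `ω` replaced by `ω₀`. -/
def admissibleTimes (ω₀ α : HermitianMetric n M) : Set ℝ :=
  {s | 0 ≤ s ∧ ∃ φ : M → ℝ, ContMDiff 𝓘(ℝ, Cn n) 𝓘(ℝ, ℝ) ∞ φ ∧ ∀ x : M,
    StrictlyPositive (continuityForm ω₀ α ω₀ s x +
      Complex.I • (del (delbar (funForm φ)) x) * α.form x ^ (n - 2) +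
      reForm (Complex.I • (del (funForm φ) x *
        delbar (fun x' => α.form x' ^ (n - 2)) x)))}

/-- The number `T ∈ [0, +∞]`, the supremum of the admissible times. -/
def maximalTime (ω₀ α : HermitianMetric n M) : EReal :=
  sSup ((fun s : ℝ => (s : EReal)) '' admissibleTimes ω₀ α)

end HermitianMetric

end Manifold

end GauduchonContinuity

end

open GauduchonContinuity

open scoped Manifold ContDiff ComplexOrder

noncomputable section

namespace GauduchonContinuity

/-! ### Powers of sums of commuting elements of square zero -/

section SquareZero

variable {R : Type*} [CommRing R]

/-! The proof is a maximum principle for F = log(ω'ⁿ/ωⁿ). At a maximum point of F the gradients of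
the two log-determinants agree, so on subtracting the two equations the first-order terms cancel,
leaving ωⁿ⁻¹ - ω'ⁿ⁻¹ = -s(n-1) √-1∂∂̄F ∧ αⁿ⁻² (`form_pow_sub_form_pow`), where -√-1∂∂̄F is
semipositive. Wedging with ω gives ωⁿ ≥ ω'ⁿ⁻¹ ∧ ω, and the arithmetic-geometric mean inequality
turns this into ωⁿ ≥ ω'ⁿ at that point (`det_le_of_pow_sub_pow_eq`). Hence F ≤ 0 everywhere, and F =
0 by symmetry (`logDet_le_of_solves`). Every point is then critical and the Hessians agree, so ωⁿ⁻¹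
= ω'ⁿ⁻¹. A positive definite (1,1)-form is determined by its (n-1)-st power
(`eq_of_matForm_pow_eq`).

The algebra rests on products of two covectors being central: wedge powers of (1,1)-forms live in a
commutative ring, where `matForm_pow` and `matForm_pow_mul` express them through determinants and
adjugates. The analysis rests on `localLogDet_sub`: log det depends on the chart, but the difference
for two metrics is a function on M. -/

theorem add_pow_succ_of_sq_eq_zero {e : R} (he : e * e = 0) (a : R) (m : ℕ) :
    (e + a) ^ (m + 1) = a ^ (m + 1) + (m + 1) * (e * a ^ m) := by
  induction m with
  | zero => simp; ring
  | succ m ih =>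
    rw [pow_succ, ih]
    push_cast
    linear_combination ((m : R) + 1) * a ^ m * he

/-- The vanishing of the next power is carried along because it kills the first term of
`add_pow_succ_of_sq_eq_zero` in the induction. -/
theorem sum_pow_card_of_sq_eq_zero {ι : Type*} (e : ι → R) (he : ∀ i, e i * e i = 0)
    (t : Finset ι) :
    (∑ i ∈ t, e i) ^ t.card = (t.card.factorial : R) * ∏ i ∈ t, e i ∧
      (∑ i ∈ t, e i) ^ (t.card + 1) = 0 := by
  classical
  induction t using Finset.induction_on with
  | empty => simp
  | insert a t ha ih =>
    rw [Finset.sum_insert ha, Finset.prod_insert ha, Finset.card_insert_of_notMem ha,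
      add_pow_succ_of_sq_eq_zero (he a), add_pow_succ_of_sq_eq_zero (he a), pow_succ _ (t.card + 1),
      ih.1, ih.2, Nat.factorial_succ]
    push_cast
    constructor <;> ring

/-- This is the coefficient of X in the preceding identity for the elements eᵢ + X fᵢ of `R[X]`,
which again have square zero; it is extracted by differentiating at 0. -/
theorem card_mul_sum_pow_mul_sum {ι : Type*} [Fintype ι] [DecidableEq ι] (e f : ι → R)
    (hee : ∀ i, e i * e i = 0) (hef : ∀ i, e i * f i = 0) (hff : ∀ i, f i * f i = 0) :
    (Fintype.card ι : R) * (∑ i, e i) ^ (Fintype.card ι - 1) * ∑ i, f i =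
      ((Fintype.card ι).factorial : R) * ∑ m, ∏ i, (if i = m then f i else e i) := by
  open Polynomial in
  have key := (sum_pow_card_of_sq_eq_zero (fun i => C (e i) + X * C (f i)) (fun i => by
    have h1 : (C (e i) : R[X]) * C (e i) = 0 := by rw [← C_mul, hee, C_0]
    have h2 : (C (e i) : R[X]) * C (f i) = 0 := by rw [← C_mul, hef, C_0]
    have h3 : (C (f i) : R[X]) * C (f i) = 0 := by rw [← C_mul, hff, C_0]
    linear_combination h1 + 2 * X * h2 + X ^ 2 * h3) Finset.univ).1
  have h := congrArg (fun p => Polynomial.eval 0 (Polynomial.derivative p)) key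
  simp only [Polynomial.derivative_pow, Polynomial.derivative_sum, Polynomial.derivative_add,
    Polynomial.derivative_C, Polynomial.derivative_mul, Polynomial.derivative_X,
    Polynomial.derivative_natCast, Polynomial.derivative_prod_finset, Polynomial.eval_mul,
    Polynomial.eval_pow, Polynomial.eval_finsetSum, Polynomial.eval_add, Polynomial.eval_C,
    Polynomial.eval_X, Polynomial.eval_natCast, zero_mul, mul_zero, add_zero, zero_add, one_mul,
    Polynomial.eval_prod, Finset.card_univ] at h
  rw [h]
  congr 1
  refine Finset.sum_congr rfl fun m _ => ?_
  rw [← Finset.mul_prod_erase Finset.univ (fun i => if i = m then f i else e i)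
    (Finset.mem_univ m), mul_comm]
  simp only [if_true]
  congr 1
  exact Finset.prod_congr rfl fun i hi => (if_neg (Finset.ne_of_mem_erase hi)).symm

end SquareZero

/-- An alternating map evaluated at linear combinations of `n` vectors. -/
theorem alternatingMap_sum_smul {n : ℕ} {V W : Type*} [AddCommGroup V] [Module ℂ V]
    [AddCommGroup W] [Module ℂ W] (f : V [⋀^Fin n]→ₗ[ℂ] W) (A : Matrix (Fin n) (Fin n) ℂ)
    (b : Fin n → V) : f (fun k => ∑ j, A k j • b j) = A.det • f b := by
  -- Linear functionals separate points, so W may be replaced by ℂ; there every alternating n-form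
  -- on ℂⁿ is a multiple of the determinant.
  rw [← sub_eq_zero, ← Module.forall_dual_apply_eq_zero_iff ℂ]
  intro l
  have h := ((l.compAlternatingMap f).compLinearMap
    (Fintype.linearCombination ℂ b)).eq_smul_basis_det (Pi.basisFun ℂ (Fin n))
  have h1 : l (f fun k => Fintype.linearCombination ℂ b (A k)) =
      l (f fun k => Fintype.linearCombination ℂ b (Pi.basisFun ℂ (Fin n) k)) *
        (Pi.basisFun ℂ (Fin n)).det A := congrArg (fun g => g A) h
  rw [map_sub, map_smul, sub_eq_zero, smul_eq_mul, mul_comm]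
  simp only [Fintype.linearCombination_apply, Pi.basisFun_apply] at h1
  rw [h1, Pi.basisFun_det]
  simp [Pi.single_apply, Matrix.det]

/-! ### `(1,1)`-forms in the centre of the exterior algebra -/

/-- The centre of the exterior algebra. -/
abbrev CentralForm (n : ℕ) : Type := Subalgebra.center ℂ (Form n)

theorem oneForm_mul_swap {n : ℕ} (a b : Covec n) :
    oneForm a * oneForm b = -(oneForm b * oneForm a) :=
  eq_neg_of_add_eq_zero_left (ExteriorAlgebra.ι_add_mul_swap a b)

theorem oneForm_mul_self {n : ℕ} (a : Covec n) : oneForm a * oneForm a = 0 :=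
  ExteriorAlgebra.ι_sq_zero a

/-- Moving a covector past two others changes the sign twice. This places (1,1)-forms in a
commutative ring. -/
theorem oneForm_mul_oneForm_mem_center {n : ℕ} (a b : Covec n) :
    oneForm a * oneForm b ∈ Subalgebra.center ℂ (Form n) := by
  rw [Subalgebra.mem_center_iff]
  intro x
  induction x using ExteriorAlgebra.induction with
  | algebraMap r => exact Algebra.commutes r _
  | ι c =>
    change oneForm c * _ = _ * oneForm c
    rw [← mul_assoc, oneForm_mul_swap c a, neg_mul, mul_assoc, oneForm_mul_swap c b, mul_neg,
      neg_neg, mul_assoc]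
  | mul x y hx hy => rw [mul_assoc, hy, ← mul_assoc, hx, mul_assoc]
  | add x y hx hy => rw [add_mul, mul_add, hx, hy]

/-- The form `√-1 a ∧ b`, as a bilinear map into the centre. -/
def pairForm {n : ℕ} : Covec n →ₗ[ℂ] Covec n →ₗ[ℂ] CentralForm n :=
  LinearMap.mk₂ ℂ (fun a b => Complex.I • ⟨oneForm a * oneForm b, oneForm_mul_oneForm_mem_center a b⟩)
    (fun a a' b => by
      ext; simp [oneForm, add_mul])
    (fun c a b => by
      ext; simp [oneForm, smul_comm c Complex.I])
    (fun a b b' => by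
      ext; simp [oneForm, mul_add])
    (fun c a b => by
      ext; simp [oneForm, smul_comm c Complex.I])

theorem coe_pairForm {n : ℕ} (a b : Covec n) :
    (pairForm a b : Form n) = Complex.I • (oneForm a * oneForm b) := rfl

theorem pairForm_mul_left {n : ℕ} (a b c : Covec n) : pairForm a b * pairForm a c = 0 := by
  ext
  have : oneForm a * oneForm b * (oneForm a * oneForm c) = 0 := by
    rw [oneForm_mul_swap a b, neg_mul, mul_assoc, ← mul_assoc (oneForm a), oneForm_mul_self,
      zero_mul, mul_zero, neg_zero]
  simp [coe_pairForm, this]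

theorem pairForm_mul_right {n : ℕ} (a b c : Covec n) : pairForm a c * pairForm b c = 0 := by
  ext
  have : oneForm a * oneForm c * (oneForm b * oneForm c) = 0 := by
    rw [oneForm_mul_swap b c, mul_neg, mul_assoc, ← mul_assoc (oneForm c), oneForm_mul_self,
      zero_mul, mul_zero, neg_zero]
  simp [coe_pairForm, this]

theorem prod_eq_zero_of_mul_eq_zero {R ι : Type*} [CommRing R] [Fintype ι] [DecidableEq ι]
    (f : ι → R) {i j : ι} (hij : i ≠ j) (h : f i * f j = 0) : ∏ k, f k = 0 := by
  rw [← Finset.mul_prod_erase _ _ (Finset.mem_univ i), ← Finset.mul_prod_erase _ _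
    (Finset.mem_erase.2 ⟨hij.symm, Finset.mem_univ j⟩), ← mul_assoc, h, zero_mul]

/-- `∏ₖ √-1 aₖ ∧ bₖ` as an alternating map in `b`. -/
def pairProdRight {n : ℕ} (a : Fin n → Covec n) : Covec n [⋀^Fin n]→ₗ[ℂ] CentralForm n :=
  { (MultilinearMap.mkPiAlgebra ℂ (Fin n) (CentralForm n)).compLinearMap
      (fun k => pairForm (a k)) with
    map_eq_zero_of_eq' := fun v i j hv hij => by
      change ∏ k, pairForm (a k) (v k) = 0
      exact prod_eq_zero_of_mul_eq_zero _ hij (by rw [hv, pairForm_mul_right]) }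

theorem pairProdRight_apply {n : ℕ} (a b : Fin n → Covec n) :
    pairProdRight a b = ∏ k, pairForm (a k) (b k) := rfl

/-- `∏ₖ √-1 aₖ ∧ bₖ` as an alternating map in `a`. -/
def pairProdLeft {n : ℕ} (b : Fin n → Covec n) : Covec n [⋀^Fin n]→ₗ[ℂ] CentralForm n :=
  { (MultilinearMap.mkPiAlgebra ℂ (Fin n) (CentralForm n)).compLinearMap
      (fun k => pairForm.flip (b k)) with
    map_eq_zero_of_eq' := fun v i j hv hij => by
      change ∏ k, pairForm (v k) (b k) = 0
      exact prod_eq_zero_of_mul_eq_zero _ hij (by rw [hv, pairForm_mul_left]) }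

theorem pairProdLeft_apply {n : ℕ} (a b : Fin n → Covec n) :
    pairProdLeft b a = ∏ k, pairForm (a k) (b k) := rfl

/-- The standard volume form `∏ₖ √-1 dzᵏ ∧ dz̄ᵏ`. -/
def volForm (n : ℕ) : CentralForm n := ∏ k, pairForm (dz k) (dzbar k)

/-- The form `√-1 ∑ Gᵢⱼ dzⁱ ∧ dz̄ʲ`. -/
def matForm {n : ℕ} (G : Matrix (Fin n) (Fin n) ℂ) : CentralForm n :=
  ∑ i, pairForm (dz i) (∑ j, G i j • dzbar j)

theorem coe_matForm {n : ℕ} (G : Matrix (Fin n) (Fin n) ℂ) :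
    (matForm G : Form n) = Complex.I • ∑ i, ∑ j, G i j • (oneForm (dz i) * oneForm (dzbar j)) := by
  simp [matForm, coe_pairForm, Finset.smul_sum, smul_comm _ Complex.I]

theorem matForm_smul {n : ℕ} (c : ℂ) (G : Matrix (Fin n) (Fin n) ℂ) :
    matForm (c • G) = c • matForm G := by
  simp [matForm, Finset.smul_sum, mul_smul]

theorem prod_pairForm_dz {n : ℕ} (G : Matrix (Fin n) (Fin n) ℂ) :
    ∏ i, pairForm (dz i) (∑ j, G i j • dzbar j) = G.det • volForm n := by
  rw [← pairProdRight_apply, alternatingMap_sum_smul, pairProdRight_apply]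
  rfl

/-- Grouped by rows of G, `matForm G` is a sum of n elements of square zero, since row i always
contains dzⁱ. Its n-th power is n! times their product, which is alternating in the rows. -/
theorem matForm_pow {n : ℕ} (G : Matrix (Fin n) (Fin n) ℂ) :
    matForm G ^ n = ((n.factorial : ℂ) * G.det) • volForm n := by
  have h := (sum_pow_card_of_sq_eq_zero (fun i => pairForm (dz i) (∑ j, G i j • dzbar j))
    (fun i => pairForm_mul_left _ _ _) Finset.univ).1
  rw [Finset.card_univ, Fintype.card_fin, prod_pairForm_dz] at h
  rw [matForm, h, mul_smul]
  simp [Algebra.smul_def]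

/-- The polarised version of `matForm_pow`: the sum of the determinants of G with one row replaced
by that of B is tr(B adj G). -/
theorem matForm_pow_mul {n : ℕ} (G B : Matrix (Fin n) (Fin n) ℂ) :
    (n : ℂ) • (matForm G ^ (n - 1) * matForm B) =
      ((n.factorial : ℂ) * (B * G.adjugate).trace) • volForm n := by
  have h := card_mul_sum_pow_mul_sum (fun i => pairForm (dz i) (∑ j, G i j • dzbar j))
    (fun i => pairForm (dz i) (∑ j, B i j • dzbar j))
    (fun i => pairForm_mul_left _ _ _) (fun i => pairForm_mul_left _ _ _)
    (fun i => pairForm_mul_left _ _ _)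
  rw [Fintype.card_fin] at h
  have h2 : ∀ m, ∏ i, (if i = m then pairForm (dz i) (∑ j, B i j • dzbar j)
      else pairForm (dz i) (∑ j, G i j • dzbar j)) = ((B * G.adjugate) m m) • volForm n := by
    intro m
    -- Cramer's rule, that is, expansion along the replaced row.
    have : (B * G.adjugate) m m = (G.updateRow m (B m)).det := by
      rw [← Matrix.cramer_transpose_apply, Matrix.mul_apply, Matrix.cramer_eq_adjugate_mulVec,
        Matrix.mulVec, dotProduct, ← Matrix.adjugate_transpose]
      simp [mul_comm, Matrix.transpose_apply]
    rw [this, ← prod_pairForm_dz]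
    refine Finset.prod_congr rfl fun i _ => ?_
    by_cases him : i = m
    · subst him; simp
    · simp [him]
  simp only [h2, ← Finset.sum_smul] at h
  rw [mul_smul, Matrix.trace]
  simp only [Algebra.smul_def, map_natCast, Matrix.diag_apply]
  rw [← mul_assoc]
  simpa only [Algebra.smul_def, matForm] using h

/-! ### The volume form is not zero -/

/-- The coordinates of a covector with respect to `dz⁰, dz̄⁰, dz¹, dz̄¹, …`. -/
def covecCoord (n : ℕ) : Covec n →ₗ[ℂ] (Fin (n * 2) → ℂ) where
  toFun f k := (1 / 2 : ℂ) * (f (stdVec (finProdFinEquiv.symm k).1) +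
    (if (finProdFinEquiv.symm k).2 = 0 then -1 else 1) * Complex.I *
      f (Complex.I • stdVec (finProdFinEquiv.symm k).1))
  map_add' f g := by ext k; simp only [Pi.add_apply, LinearMap.add_apply]; ring
  map_smul' c f := by
    ext k
    simp only [Pi.smul_apply, LinearMap.smul_apply, smul_eq_mul, RingHom.id_apply]
    ring

theorem dz_apply {n : ℕ} (i : Fin n) (v : Cn n) : dz i v = v i := rfl

theorem dzbar_apply {n : ℕ} (i : Fin n) (v : Cn n) : dzbar i v = starRingEnd ℂ (v i) := rfl

/-- The alternating form `det ∘ covecCoord` takes the value 1 on the covectors dz⁰, dz̄⁰, dz¹, dz̄¹,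
…, so their wedge product is nonzero. The interleaved order matches `volForm` without a permutation
sign. -/
theorem volForm_ne_zero (n : ℕ) : volForm n ≠ 0 := by
  set v : Fin (n * 2) → Covec n := fun k =>
    if (finProdFinEquiv.symm k).2 = 0 then dz (finProdFinEquiv.symm k).1
    else dzbar (finProdFinEquiv.symm k).1 with hv
  have h1 : ExteriorAlgebra.ιMulti ℂ (n * 2) v ≠ 0 := by
    intro h0
    have h := ExteriorAlgebra.liftAlternating_apply_ιMulti
      (Pi.single (n * 2) ((Pi.basisFun ℂ (Fin (n * 2))).det.compLinearMap (covecCoord n))) v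
    rw [h0, map_zero, Pi.single_eq_same, AlternatingMap.compLinearMap_apply] at h
    have h2 : (fun i => covecCoord n (v i)) = Pi.basisFun ℂ (Fin (n * 2)) := by
      funext k l
      rw [Pi.basisFun_apply]
      obtain ⟨⟨a, b⟩, rfl⟩ := finProdFinEquiv.surjective k
      obtain ⟨⟨c, d⟩, rfl⟩ := finProdFinEquiv.surjective l
      simp only [hv, covecCoord, LinearMap.coe_mk, AddHom.coe_mk, Equiv.symm_apply_apply,
        Pi.single_apply, EmbeddingLike.apply_eq_iff_eq, Prod.mk.injEq]
      by_cases hac : c = a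
      · subst hac
        fin_cases b <;> fin_cases d <;>
          simp [dz_apply, dzbar_apply, stdVec, Complex.I_mul_I] <;> norm_num
      · fin_cases b <;> fin_cases d <;>
          simp [dz_apply, dzbar_apply, stdVec, hac, Ne.symm hac, eq_comm]
    rw [show ((fun i => covecCoord n (v i)) : Fin (n * 2) → Fin (n * 2) → ℂ) = _ from h2,
      Module.Basis.det_self] at h
    exact zero_ne_one h
  intro h0
  apply h1
  have h3 : ((∏ k, pairForm (dz k) (dzbar k) : CentralForm n) : Form n) =
      Complex.I ^ n • (List.ofFn fun k : Fin n => oneForm (dz k) * oneForm (dzbar k)).prod := by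
    rw [← List.prod_ofFn]
    have := map_list_prod (Subalgebra.center ℂ (Form n)).val
      (List.ofFn fun k : Fin n => pairForm (dz k) (dzbar k))
    rw [Subalgebra.coe_val] at this
    rw [this, List.map_ofFn]
    have aux : ∀ (m : ℕ) (f : Fin m → Form n), (List.ofFn fun k => Complex.I • f k).prod =
        Complex.I ^ m • (List.ofFn f).prod := by
      intro m
      induction m with
      | zero => simp
      | succ m ih => intro f; simp [List.ofFn_succ, ih, pow_succ, smul_smul]
    exact aux n _
  have h4 : ExteriorAlgebra.ιMulti ℂ (n * 2) v =
      (List.ofFn fun k : Fin n => oneForm (dz k) * oneForm (dzbar k)).prod := by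
    rw [ExteriorAlgebra.ιMulti_apply, List.ofFn_mul, List.prod_flatten, List.map_ofFn]
    congr 2
    funext i
    have e : ∀ j : Fin 2, (finProdFinEquiv.symm
        (⟨i * 2 + j, by have := i.isLt; have := j.isLt; omega⟩ : Fin (n * 2))) = (i, j) := by
      intro j
      rw [Equiv.symm_apply_eq]
      ext
      simp [finProdFinEquiv]; ring
    have e0 := e 0
    have e1 := e 1
    simp only [Function.comp, List.ofFn_succ, List.ofFn_zero, List.prod_cons, List.prod_nil, mul_one]
    simp only [hv]
    erw [e0, e1]
    simp [oneForm]
  have h5 : Complex.I ^ n • ExteriorAlgebra.ιMulti ℂ (n * 2) v = 0 := by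
    rw [h4, ← h3]
    exact congrArg Subtype.val h0
  exact (smul_eq_zero.1 h5).resolve_left (pow_ne_zero _ Complex.I_ne_zero)

/-! ### Positivity -/

/-- The elementary semipositive `(1,1)`-forms `√-1 θ ∧ θ̄` with `θ = ∑ vⱼ dzʲ`. -/
def elementaryForms (n : ℕ) : Set (CentralForm n) :=
  Set.range fun v : Fin n → ℂ =>
    pairForm (∑ j, v j • dz j) (∑ j, starRingEnd ℂ (v j) • dzbar j)

/-- The cone of nonnegative forms of top degree. -/
def topCone (n : ℕ) : AddSubmonoid (CentralForm n) where
  carrier := {x | ∃ c : ℝ, 0 ≤ c ∧ x = (c : ℂ) • volForm n}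
  zero_mem' := ⟨0, le_rfl, by simp⟩
  add_mem' := by
    rintro _ _ ⟨c, hc, rfl⟩ ⟨d, hd, rfl⟩
    exact ⟨c + d, add_nonneg hc hd, by push_cast; rw [add_smul]⟩

open scoped Pointwise in
-- It suffices to treat products of n generators. Such a product is alternating in its dz-factors
-- and in its dz̄-factors, which contribute det v and its conjugate, so it is |det v|² times the
-- volume form.
theorem closure_elementaryForms_pow_le (n : ℕ) :
    AddSubmonoid.closure (elementaryForms n) ^ n ≤ topCone n := by
  rw [AddSubmonoid.closure_pow, AddSubmonoid.closure_le]
  intro x hx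
  obtain ⟨f, rfl⟩ := Set.mem_pow.1 hx
  choose v hv using fun i => (f i).2
  rw [List.prod_ofFn]
  refine ⟨Complex.normSq (Matrix.of v).det, Complex.normSq_nonneg _, ?_⟩
  simp only [← hv]
  rw [← pairProdLeft_apply]
  refine (alternatingMap_sum_smul (pairProdLeft _) (Matrix.of v) dz).trans ?_
  have h := alternatingMap_sum_smul (pairProdRight dz) ((starRingEnd ℂ).mapMatrix (Matrix.of v))
    dzbar
  rw [← RingHom.map_det] at h
  rw [pairProdLeft_apply, ← pairProdRight_apply]
  refine (congrArg _ h).trans ?_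
  rw [smul_smul, Complex.mul_conj]
  rfl

open scoped MatrixOrder in
theorem exists_eq_conjTranspose_mul_self {n : ℕ} {H : Matrix (Fin n) (Fin n) ℂ}
    (hH : H.PosSemidef) : ∃ B : Matrix (Fin n) (Fin n) ℂ, H = B.conjTranspose * B := by
  obtain ⟨X, hX, -, hX'⟩ := CFC.exists_sqrt_of_isSelfAdjoint_of_quasispectrumRestricts
    hH.isHermitian (QuasispectrumRestricts.nnreal_of_nonneg hH.nonneg)
  exact ⟨X, by rw [← hX']; exact congrArg (· * X) hX.star_eq.symm⟩

/-- Writing H = B*B splits the form into elementary ones, one for each row of B. -/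
theorem matForm_mem_closure {n : ℕ} {H : Matrix (Fin n) (Fin n) ℂ} (hH : H.PosSemidef) :
    matForm H ∈ AddSubmonoid.closure (elementaryForms n) := by
  obtain ⟨B, rfl⟩ := exists_eq_conjTranspose_mul_self hH
  have : matForm (B.conjTranspose * B) =
      ∑ k, pairForm (∑ j, starRingEnd ℂ (B k j) • dz j) (∑ j, B k j • dzbar j) := by
    simp only [matForm, Matrix.mul_apply, Matrix.conjTranspose_apply, map_sum, map_smul,
      LinearMap.sum_apply, LinearMap.smul_apply, Finset.sum_smul]
    conv_rhs => rw [Finset.sum_comm]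
    rw [Finset.sum_comm]
    refine Finset.sum_congr rfl fun i _ => ?_
    rw [Finset.sum_comm]
    refine Finset.sum_congr rfl fun k _ => ?_
    rw [Finset.smul_sum]
    exact Finset.sum_congr rfl fun j _ => by rw [smul_smul, mul_comm]; rfl
  rw [this]
  refine sum_mem fun k _ => AddSubmonoid.subset_closure ⟨fun j => starRingEnd ℂ (B k j), ?_⟩
  simp

open scoped Pointwise in
theorem matForm_mul_pow_mul_mem_topCone {n : ℕ} (hn : 2 ≤ n) {H A G : Matrix (Fin n) (Fin n) ℂ}
    (hH : H.PosSemidef) (hA : A.PosSemidef) (hG : G.PosSemidef) :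
    matForm H * matForm A ^ (n - 2) * matForm G ∈ topCone n := by
  apply closure_elementaryForms_pow_le
  have e : AddSubmonoid.closure (elementaryForms n) ^ n =
      AddSubmonoid.closure (elementaryForms n) * AddSubmonoid.closure (elementaryForms n) ^ (n - 2) *
        AddSubmonoid.closure (elementaryForms n) := by
    rw [← pow_succ', ← pow_succ]
    congr 1
    omega
  rw [e]
  exact AddSubmonoid.mul_mem_mul (AddSubmonoid.mul_mem_mul (matForm_mem_closure hH)
    (AddSubmonoid.pow_subset_pow (Set.pow_mem_pow (matForm_mem_closure hA))))
    (matForm_mem_closure hG)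

/-- The arithmetic-geometric mean inequality for the eigenvalues of a semipositive matrix. -/
theorem det_re_le_trace_div_pow {n : ℕ} (hn : n ≠ 0) {P : Matrix (Fin n) (Fin n) ℂ}
    (hP : P.PosSemidef) : P.det.re ≤ (P.trace.re / n) ^ n := by
  rw [hP.1.det_eq_prod_eigenvalues, hP.1.trace_eq_sum_eigenvalues]
  have h := Real.geom_mean_le_arith_mean Finset.univ (fun _ => 1) hP.1.eigenvalues
    (fun _ _ => zero_le_one) (by simpa using Nat.pos_of_ne_zero hn) (fun i _ => hP.eigenvalues_nonneg i)
  simp only [Real.rpow_one, Finset.sum_const, Finset.card_univ, Fintype.card_fin, nsmul_eq_mul,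
    mul_one, one_mul] at h
  have h0 : 0 ≤ ∏ i, hP.1.eigenvalues i := Finset.prod_nonneg fun i _ => hP.eigenvalues_nonneg i
  have h2 := pow_le_pow_left₀ (Real.rpow_nonneg h0 _) h n
  rw [Real.rpow_inv_natCast_pow h0 hn] at h2
  have e1 : ∏ i, ((hP.1.eigenvalues i : ℝ) : ℂ) = ((∏ i, hP.1.eigenvalues i : ℝ) : ℂ) := by
    push_cast; rfl
  have e2 : ∑ i, ((hP.1.eigenvalues i : ℝ) : ℂ) = ((∑ i, hP.1.eigenvalues i : ℝ) : ℂ) := by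
    push_cast; rfl
  erw [e1, e2]
  rw [Complex.ofReal_re, Complex.ofReal_re]
  exact h2

theorem det_eq_ofReal_re {n : ℕ} {G : Matrix (Fin n) (Fin n) ℂ} (hG : G.PosDef) :
    G.det = (G.det.re : ℂ) ∧ 0 < G.det.re := by
  have h := Complex.lt_def.1 hG.det_pos
  exact ⟨Complex.ext rfl (by simpa using h.2.symm), by simpa using h.1⟩

/-- Wedging the hypothesis with the form of G gives tr(G adj G') ≤ n det G. With G = R*R, the
arithmetic-geometric mean inequality for R (adj G') R* gives det G (det G')ⁿ⁻¹ ≤ (tr(G adj G')/n)ⁿ ≤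
(det G)ⁿ. -/
theorem det_le_of_pow_sub_pow_eq {n : ℕ} (hn : 2 ≤ n) {G G' H A : Matrix (Fin n) (Fin n) ℂ}
    (hG : G.PosDef) (hG' : G'.PosDef) (hH : H.PosSemidef) (hA : A.PosSemidef)
    (h : matForm G ^ (n - 1) - matForm G' ^ (n - 1) = matForm H * matForm A ^ (n - 2)) :
    G'.det.re ≤ G.det.re := by
  have hn0 : n ≠ 0 := by omega
  have hnR : (0 : ℝ) < n := by positivity
  obtain ⟨c, hc, hc'⟩ := matForm_mul_pow_mul_mem_topCone hn hH hA hG.posSemidef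
  rw [← h] at hc'
  have hc'' : matForm G ^ (n - 1) * matForm G - matForm G' ^ (n - 1) * matForm G =
    (c : ℂ) • volForm n := (sub_mul _ _ _).symm.trans hc'
  have h1 := congrArg (fun x => (n : ℂ) • x) hc''
  simp only [smul_sub, matForm_pow_mul, ← sub_smul, smul_smul] at h1
  have h2 := smul_left_injective ℂ (volForm_ne_zero n) h1
  obtain ⟨dG, dGp⟩ := det_eq_ofReal_re hG
  obtain ⟨dG', dGp'⟩ := det_eq_ofReal_re hG'
  obtain ⟨R, hR⟩ := exists_eq_conjTranspose_mul_self hG.posSemidef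
  have hadj : G'.adjugate.PosSemidef := by
    have : G'.adjugate = G'.det • G'⁻¹ := by
      rw [Matrix.inv_def, Ring.inverse_eq_inv', smul_smul, mul_inv_cancel₀ hG'.det_pos.ne',
        one_smul]
    rw [this]
    exact hG'.inv.posSemidef.smul hG'.det_pos.le
  have hP : (R * G'.adjugate * R.conjTranspose).PosSemidef := hadj.mul_mul_conjTranspose_same R
  have htr : (G * G'.adjugate).trace = (R * G'.adjugate * R.conjTranspose).trace := by
    rw [hR, Matrix.trace_mul_comm, ← Matrix.mul_assoc, Matrix.trace_mul_comm, ← Matrix.mul_assoc]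
  have hdet : (R * G'.adjugate * R.conjTranspose).det.re = G.det.re * G'.det.re ^ (n - 1) := by
    have e : (R * G'.adjugate * R.conjTranspose).det = G.det * G'.det ^ (n - 1) := by
      rw [hR, Matrix.det_mul, Matrix.det_mul, Matrix.det_mul, Matrix.det_adjugate, Fintype.card_fin]
      ring
    have e' : G.det * G'.det ^ (n - 1) = ((G.det.re * G'.det.re ^ (n - 1) : ℝ) : ℂ) := by
      push_cast
      rw [← dG, ← dG']
    rw [e, e', Complex.ofReal_re]
  have hamgm := det_re_le_trace_div_pow hn0 hP
  rw [hdet, ← htr] at hamgm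
  have htr0 : 0 ≤ (G * G'.adjugate).trace.re := by
    rw [htr]
    exact (Complex.le_def.1 hP.trace_nonneg).1
  have hle : (G * G'.adjugate).trace.re / n ≤ G.det.re := by
    rw [div_le_iff₀ hnR]
    have h3 := congrArg Complex.re h2
    rw [Matrix.mul_adjugate, Matrix.trace_smul, Matrix.trace_one, Fintype.card_fin, dG] at h3
    have h4 : (n.factorial : ℝ) * (G.det.re * n) - n.factorial * (G * G'.adjugate).trace.re = n * c := by
      have := h3
      simpa [Complex.mul_re] using this
    have h5 : (0 : ℝ) < n.factorial := by positivity
    have h6 : 0 ≤ n * c := by positivity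
    nlinarith
  have h7 : G.det.re * G'.det.re ^ (n - 1) ≤ G.det.re * G.det.re ^ (n - 1) := by
    rw [← pow_succ' G.det.re, Nat.sub_add_cancel (by omega)]
    exact hamgm.trans (pow_le_pow_left₀ (by positivity) hle n)
  -- Cancel det G > 0 and take (n-1)-st roots.
  exact le_of_pow_le_pow_left₀ (by omega) dGp.le (le_of_mul_le_mul_left h7 dGp)

/-- Pairing the (n-1)-st power with all (1,1)-forms recovers the adjugate. Its determinant (det
G)ⁿ⁻¹ recovers det G > 0, and adj(adj G) = (det G)ⁿ⁻² G recovers G. -/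
theorem eq_of_matForm_pow_eq {n : ℕ} (hn : 2 ≤ n) {G G' : Matrix (Fin n) (Fin n) ℂ}
    (hG : G.PosDef) (hG' : G'.PosDef) (h : matForm G ^ (n - 1) = matForm G' ^ (n - 1)) :
    G = G' := by
  have hadj : G.adjugate = G'.adjugate := by
    refine Matrix.ext_iff_trace_mul_left.2 fun B => ?_
    have h1 := matForm_pow_mul G B
    rw [h, matForm_pow_mul] at h1
    have h2 := smul_left_injective ℂ (volForm_ne_zero n) h1
    exact (mul_left_cancel₀ (by exact_mod_cast n.factorial_ne_zero) h2).symm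
  obtain ⟨dG, dGp⟩ := det_eq_ofReal_re hG
  obtain ⟨dG', dGp'⟩ := det_eq_ofReal_re hG'
  have hdet : G.det = G'.det := by
    have h1 := congrArg Matrix.det hadj
    rw [Matrix.det_adjugate, Matrix.det_adjugate, dG, dG', Fintype.card_fin] at h1
    rw [dG, dG', (pow_left_inj₀ dGp.le dGp'.le (by omega : n - 1 ≠ 0)).1 (by exact_mod_cast h1)]
  have h1 := congrArg Matrix.adjugate hadj
  rw [Matrix.adjugate_adjugate G (by simp; omega), Matrix.adjugate_adjugate G' (by simp; omega), hdet] at h1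
  exact smul_right_injective _ (pow_ne_zero _ hG'.det_pos.ne') h1

/-- Since the volume form is nonzero, the ratio is unique, and the choice made in `topRatio` is
forced. -/
theorem topRatio_matForm {n : ℕ} {G A : Matrix (Fin n) (Fin n) ℂ} (hG : G.PosDef) (hA : A.PosDef) :
    topRatio ((matForm G : Form n) ^ n) ((matForm A : Form n) ^ n) = G.det.re / A.det.re := by
  obtain ⟨dG, dGp⟩ := det_eq_ofReal_re hG
  obtain ⟨dA, dAp⟩ := det_eq_ofReal_re hA
  have key : ∀ c : ℝ, (matForm G : Form n) ^ n = (c : ℂ) • (matForm A : Form n) ^ n ↔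
      c = G.det.re / A.det.re := by
    intro c
    rw [eq_div_iff dAp.ne']
    have : (matForm G : Form n) ^ n = (c : ℂ) • (matForm A : Form n) ^ n ↔
        matForm G ^ n = (c : ℂ) • matForm A ^ n := by
      rw [Subtype.ext_iff]; rfl
    rw [this, matForm_pow, matForm_pow, smul_smul, (smul_left_injective ℂ (volForm_ne_zero n)).eq_iff,
      dG, dA]
    have hf : (n.factorial : ℂ) ≠ 0 := by exact_mod_cast n.factorial_ne_zero
    constructor
    · intro h
      have : (n.factorial : ℂ) * ((c * A.det.re : ℝ) : ℂ) = n.factorial * (G.det.re : ℂ) := by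
        push_cast; rw [h]; ring
      exact_mod_cast mul_left_cancel₀ hf this
    · intro h
      simp only [Complex.ofReal_re] at h
      rw [← h]; push_cast; ring
  have hex : ∃ c : ℝ, (matForm G : Form n) ^ n = (c : ℂ) • (matForm A : Form n) ^ n :=
    ⟨_, (key _).2 rfl⟩
  rw [topRatio, dif_pos hex]
  exact (key _).1 hex.choose_spec

/-! ### The sesquilinear form attached to a real bilinear form -/

section Sesquilinear

variable {n : ℕ}

/-- The sesquilinear form `B(v, w) + B(Iv, Iw) + √-1 (B(v, Iw) - B(Iv, w))`. -/
def sesqForm (B : Cn n →L[ℝ] Cn n →L[ℝ] ℝ) : Cn n →ₗ[ℂ] Cn n →ₗ⋆[ℂ] ℂ :=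
  LinearMap.mk₂'ₛₗ (RingHom.id ℂ) (starRingEnd ℂ)
    (fun v w => ((B v w + B (Complex.I • v) (Complex.I • w) : ℝ) : ℂ) +
      Complex.I * ((B v (Complex.I • w) - B (Complex.I • v) w : ℝ) : ℂ))
    (fun v v' w => by simp; ring)
    (fun c v w => by
      have h : c • v = c.re • v + c.im • (Complex.I • v) := by
        conv_lhs => rw [← Complex.re_add_im c, add_smul, mul_smul]
        rfl
      have h' : Complex.I • (c • v) = c.re • (Complex.I • v) - c.im • v := by
        rw [h, smul_add, smul_comm Complex.I c.im, smul_smul Complex.I, Complex.I_mul_I, neg_smul,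
          one_smul, smul_neg, smul_comm, sub_eq_add_neg]
      rw [h', h]
      conv_rhs => rw [RingHom.id_apply, smul_eq_mul]; enter [1]; rw [← Complex.re_add_im c]
      simp only [map_add, map_sub, map_smul, add_apply, sub_apply, smul_apply, smul_eq_mul]
      push_cast
      linear_combination (-(c.im : ℂ) * (B v (Complex.I • w) - B (Complex.I • v) w)) * Complex.I_sq)
    (fun v w w' => by simp; ring)
    (fun c v w => by
      have h : c • w = c.re • w + c.im • (Complex.I • w) := by
        conv_lhs => rw [← Complex.re_add_im c, add_smul, mul_smul]
        rfl
      have h' : Complex.I • (c • w) = c.re • (Complex.I • w) - c.im • w := by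
        rw [h, smul_add, smul_comm Complex.I c.im, smul_smul Complex.I, Complex.I_mul_I, neg_smul,
          one_smul, smul_neg, smul_comm, sub_eq_add_neg]
      rw [h', h]
      conv_rhs => rw [smul_eq_mul]; enter [1]; rw [← Complex.re_add_im c]
      simp only [map_add, map_sub, map_smul, map_mul, Complex.conj_I, Complex.conj_ofReal, smul_eq_mul]
      push_cast
      linear_combination ((c.im : ℂ) * (B v (Complex.I • w) - B (Complex.I • v) w)) * Complex.I_sq)

theorem sesqForm_apply (B : Cn n →L[ℝ] Cn n →L[ℝ] ℝ) (v w : Cn n) :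
    sesqForm B v w = ((B v w + B (Complex.I • v) (Complex.I • w) : ℝ) : ℂ) +
      Complex.I * ((B v (Complex.I • w) - B (Complex.I • v) w : ℝ) : ℂ) := rfl

theorem eq_sum_smul_stdVec (v : Cn n) : v = ∑ i, v i • stdVec i := by
  ext k
  simp [stdVec, Pi.single_apply]

theorem sesqForm_eq_sum (B : Cn n →L[ℝ] Cn n →L[ℝ] ℝ) (v w : Cn n) :
    sesqForm B v w = ∑ i, ∑ j, v i * starRingEnd ℂ (w j) * sesqForm B (stdVec i) (stdVec j) := by
  conv_lhs => rw [eq_sum_smul_stdVec v, eq_sum_smul_stdVec w]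
  simp only [map_sum, map_smul, LinearMap.map_smulₛₗ, LinearMap.sum_apply, LinearMap.smul_apply,
    smul_eq_mul, Finset.mul_sum]
  rw [Finset.sum_comm]
  exact Finset.sum_congr rfl fun i _ => Finset.sum_congr rfl fun j _ => by ring

/-- The matrix of `sesqForm B / 4` in the standard basis. -/
def hermMatrix (B : Cn n →L[ℝ] Cn n →L[ℝ] ℝ) : Matrix (Fin n) (Fin n) ℂ :=
  fun i j => (1 / 4 : ℂ) * sesqForm B (stdVec i) (stdVec j)

theorem hermMatrix_isHermitian {B : Cn n →L[ℝ] Cn n →L[ℝ] ℝ} (hB : ∀ v w, B v w = B w v) :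
    (hermMatrix B).IsHermitian := by
  ext i j
  simp only [Matrix.conjTranspose_apply, hermMatrix, sesqForm_apply, Complex.star_def, map_mul,
    map_add, map_div₀, map_one, map_ofNat, Complex.conj_ofReal, Complex.conj_I]
  rw [hB (stdVec j), hB (stdVec j), hB (Complex.I • stdVec j), hB (Complex.I • stdVec j)]
  push_cast
  ring

/-- The vector is conjugated because `sesqForm` is linear in its first argument; symmetry of B
cancels the imaginary part. -/
theorem star_dotProduct_hermMatrix {B : Cn n →L[ℝ] Cn n →L[ℝ] ℝ} (hB : ∀ v w, B v w = B w v)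
    (x : Fin n → ℂ) :
    dotProduct (star x) ((hermMatrix B).mulVec x) =
      ((1 / 4 * (B (WithLp.toLp 2 (star x)) (WithLp.toLp 2 (star x)) +
        B (Complex.I • WithLp.toLp 2 (star x)) (Complex.I • WithLp.toLp 2 (star x))) : ℝ) : ℂ) := by
  have h : sesqForm B (WithLp.toLp 2 (star x)) (WithLp.toLp 2 (star x)) =
      ((B (WithLp.toLp 2 (star x)) (WithLp.toLp 2 (star x)) +
        B (Complex.I • WithLp.toLp 2 (star x)) (Complex.I • WithLp.toLp 2 (star x)) : ℝ) : ℂ) := by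
    rw [sesqForm_apply, hB (Complex.I • _) (WithLp.toLp 2 (star x)), sub_self]
    simp
  rw [Complex.ofReal_mul, ← h, sesqForm_eq_sum]
  simp only [dotProduct, Matrix.mulVec, Finset.mul_sum, hermMatrix]
  refine Finset.sum_congr rfl fun i _ => Finset.sum_congr rfl fun j _ => ?_
  simp
  ring

theorem hermMatrix_posSemidef {B : Cn n →L[ℝ] Cn n →L[ℝ] ℝ} (hB : ∀ v w, B v w = B w v)
    (h : ∀ v, 0 ≤ B v v) : (hermMatrix B).PosSemidef := by
  refine .of_dotProduct_mulVec_nonneg (hermMatrix_isHermitian hB) fun x => ?_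
  rw [star_dotProduct_hermMatrix hB]
  exact_mod_cast mul_nonneg (by norm_num) (add_nonneg (h _) (h _))

theorem hermMatrix_posDef {B : Cn n →L[ℝ] Cn n →L[ℝ] ℝ} (hB : ∀ v w, B v w = B w v)
    (h : ∀ v, v ≠ 0 → 0 < B v v) : (hermMatrix B).PosDef := by
  refine .of_dotProduct_mulVec_pos (hermMatrix_isHermitian hB) fun x hx => ?_
  rw [star_dotProduct_hermMatrix hB]
  have hx' : WithLp.toLp 2 (star x) ≠ (0 : Cn n) := by
    intro h0
    apply hx
    ext i
    have := congrFun (congrArg WithLp.ofLp h0) i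
    simpa using this
  exact_mod_cast mul_pos (by norm_num)
    (add_pos (h _ hx') (h _ (smul_ne_zero Complex.I_ne_zero hx')))

/-- The matrix of a complex linear endomorphism, transposed. -/
def rowMatrix (L : Cn n →L[ℂ] Cn n) : Matrix (Fin n) (Fin n) ℂ := fun i j => L (stdVec i) j

theorem hermMatrix_comp (B B' : Cn n →L[ℝ] Cn n →L[ℝ] ℝ) (L : Cn n →L[ℂ] Cn n)
    (h : ∀ v w, B' v w = B (L v) (L w)) :
    hermMatrix B' = rowMatrix L * hermMatrix B * (rowMatrix L).conjTranspose := by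
  ext i j
  have h1 : sesqForm B' (stdVec i) (stdVec j) = sesqForm B (L (stdVec i)) (L (stdVec j)) := by
    simp only [sesqForm_apply, h, map_smul]
  rw [hermMatrix, h1, sesqForm_eq_sum]
  simp only [Matrix.mul_apply, Finset.sum_mul, Finset.mul_sum, Matrix.conjTranspose_apply,
    rowMatrix, hermMatrix]
  rw [Finset.sum_comm]
  refine Finset.sum_congr rfl fun k _ => Finset.sum_congr rfl fun l _ => ?_
  simp
  ring

/-- Invariance makes the terms agree in pairs, turning 1/4 into the 1/2 of `localMatrix`. The
normalisation 1/4 also suits Hessians, which need not be invariant. -/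
theorem hermMatrix_of_invariant {B : Cn n →L[ℝ] Cn n →L[ℝ] ℝ}
    (hJ : ∀ v w, B (Complex.I • v) (Complex.I • w) = B v w) (i j : Fin n) :
    hermMatrix B i j = (1 / 2 : ℂ) * ((B (stdVec i) (stdVec j) : ℝ) +
      Complex.I * (B (stdVec i) (Complex.I • stdVec j) : ℝ)) := by
  have h : B (Complex.I • stdVec i) (stdVec j) = -B (stdVec i) (Complex.I • stdVec j) := by
    rw [← hJ (stdVec i), smul_smul, Complex.I_mul_I, neg_one_smul, map_neg, neg_neg]
  rw [hermMatrix, sesqForm_apply, hJ, h]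
  push_cast
  ring

theorem eq_of_hermMatrix_eq {B B' : Cn n →L[ℝ] Cn n →L[ℝ] ℝ}
    (hJ : ∀ v w, B (Complex.I • v) (Complex.I • w) = B v w)
    (hJ' : ∀ v w, B' (Complex.I • v) (Complex.I • w) = B' v w)
    (h : hermMatrix B = hermMatrix B') : B = B' := by
  have h1 : ∀ v w, sesqForm B v w = sesqForm B' v w := by
    intro v w
    rw [sesqForm_eq_sum, sesqForm_eq_sum B']
    refine Finset.sum_congr rfl fun i _ => Finset.sum_congr rfl fun j _ => ?_
    congr 1
    exact mul_left_cancel₀ (by norm_num) (congrFun (congrFun h i) j)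
  ext v w
  have h2 := congrArg Complex.re (h1 v w)
  simp only [sesqForm_apply, hJ, hJ', Complex.add_re, Complex.ofReal_re, Complex.mul_re,
    Complex.I_re, Complex.I_im, Complex.ofReal_im] at h2
  linarith

end Sesquilinear

/-! ### Hermitian metrics in charts -/

section Charts

variable {n : ℕ} {M : Type*} [TopologicalSpace M] [ChartedSpace (Cn n) M]

/-- The differential of the inverse of a chart as a complex linear map. -/
def chartInvDerivC (x₀ : M) (y : Cn n) : Cn n →L[ℂ] Cn n :=
  fderiv ℂ (chartAt (Cn n) ((chartAt (Cn n) x₀).symm y) ∘ (chartAt (Cn n) x₀).symm) y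

theorem chartInvDerivC_self (x : M) :
    chartInvDerivC x (chartAt (Cn n) x x) = ContinuousLinearMap.id ℂ (Cn n) := by
  have hy := mem_chart_target (Cn n) x
  rw [chartInvDerivC, (chartAt (Cn n) x).left_inv (mem_chart_source (Cn n) x)]
  have : (chartAt (Cn n) x ∘ (chartAt (Cn n) x).symm) =ᶠ[nhds (chartAt (Cn n) x x)] id := by
    filter_upwards [(chartAt (Cn n) x).open_target.mem_nhds hy] with z hz
    exact (chartAt (Cn n) x).right_inv hz
  rw [this.fderiv_eq, fderiv_id]

variable [IsManifold 𝓘(ℂ, Cn n) ω M]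

theorem mdifferentiable_chart_real (x₀ : M) :
    (chartAt (Cn n) x₀).MDifferentiable 𝓘(ℝ, Cn n) 𝓘(ℝ, Cn n) :=
  haveI : IsManifold 𝓘(ℝ, Cn n) 1 M := IsManifold.of_le (n := ∞) (by simp)
  mdifferentiable_chart x₀

theorem chartInvDeriv_injective (x₀ : M) {y : Cn n} (hy : y ∈ (chartAt (Cn n) x₀).target) :
    Function.Injective (chartInvDeriv x₀ y) :=
  (mdifferentiable_chart_real x₀).symm.mfderiv_injective hy

/-- The differential of the inverse of a chart as an endomorphism of the model space. -/
def chartInvDerivR (x₀ : M) (y : Cn n) : Cn n →L[ℝ] Cn n := chartInvDeriv x₀ y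

/-- Tangent vectors at a point are read in the preferred chart there, so the differential of an
inverse chart is that of a transition map, hence complex linear. -/
theorem chartInvDerivR_eq_fderiv (x₀ : M) {y : Cn n} (hy : y ∈ (chartAt (Cn n) x₀).target) :
    chartInvDerivR x₀ y =
      fderiv ℝ (chartAt (Cn n) ((chartAt (Cn n) x₀).symm y) ∘ (chartAt (Cn n) x₀).symm) y := by
  have h := (mdifferentiable_chart_real x₀).symm.mdifferentiableAt hy
  refine (h.mfderiv).trans ?_
  simp only [writtenInExtChartAt, mfld_simps, fderivWithin_univ]
  rfl

theorem differentiableAt_transition (x₀ : M) {y : Cn n} (hy : y ∈ (chartAt (Cn n) x₀).target) :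
    DifferentiableAt ℂ
      (chartAt (Cn n) ((chartAt (Cn n) x₀).symm y) ∘ (chartAt (Cn n) x₀).symm) y := by
  have h := (contDiffGroupoid ω 𝓘(ℂ, Cn n)).compatible (chart_mem_atlas (Cn n) x₀)
    (chart_mem_atlas (Cn n) ((chartAt (Cn n) x₀).symm y))
  rw [contDiffGroupoid, mem_groupoid_of_pregroupoid] at h
  have h1 : ContDiffOn ℂ ω (𝓘(ℂ, Cn n) ∘ (chartAt (Cn n) x₀).symm ≫ₕ
      (chartAt (Cn n) ((chartAt (Cn n) x₀).symm y)) ∘ 𝓘(ℂ, Cn n).symm)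
    (𝓘(ℂ, Cn n).symm ⁻¹' ((chartAt (Cn n) x₀).symm ≫ₕ
      (chartAt (Cn n) ((chartAt (Cn n) x₀).symm y))).source ∩ Set.range 𝓘(ℂ, Cn n)) := h.1
  simp only [mfld_simps] at h1
  have hmem : y ∈ ((chartAt (Cn n) x₀).symm ≫ₕ
      (chartAt (Cn n) ((chartAt (Cn n) x₀).symm y))).source := by
    simp [hy]
  exact ((h1.differentiableOn (by simp)) y (by simpa using hmem)).differentiableAt
    (by simpa using (OpenPartialHomeomorph.open_source _).mem_nhds hmem)

theorem chartInvDerivR_apply (x₀ : M) {y : Cn n} (hy : y ∈ (chartAt (Cn n) x₀).target) (v : Cn n) :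
    chartInvDerivR x₀ y v = chartInvDerivC x₀ y v := by
  rw [chartInvDerivR_eq_fderiv x₀ hy, (differentiableAt_transition x₀ hy).fderiv_restrictScalars ℝ]
  rfl

namespace HermitianMetric

/-- The metric at a point, on the model space. -/
def innerCn (g : HermitianMetric n M) (x : M) : Cn n →L[ℝ] Cn n →L[ℝ] ℝ := g.inner x

/-- The expression of the metric in the preferred chart at `x₀`. -/
def chartMetric (g : HermitianMetric n M) (x₀ : M) (y : Cn n) : Cn n →L[ℝ] Cn n →L[ℝ] ℝ :=
  (g.innerCn ((chartAt (Cn n) x₀).symm y)).bilinearComp (chartInvDerivR x₀ y)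
    (chartInvDerivR x₀ y)

theorem innerCn_I_smul (g : HermitianMetric n M) (x : M) (v w : Cn n) :
    g.innerCn x (Complex.I • v) (Complex.I • w) = g.innerCn x v w := g.inner_J x v w

theorem innerCn_symm (g : HermitianMetric n M) (x : M) (v w : Cn n) :
    g.innerCn x v w = g.innerCn x w v := g.symm x v w

theorem innerCn_pos (g : HermitianMetric n M) (x : M) (v : Cn n) (hv : v ≠ 0) :
    0 < g.innerCn x v v := g.pos x v hv

theorem chartMetric_eq_inner (g : HermitianMetric n M) (x₀ : M) {y : Cn n}
    (hy : y ∈ (chartAt (Cn n) x₀).target) (v w : Cn n) :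
    g.chartMetric x₀ y v w = g.innerCn ((chartAt (Cn n) x₀).symm y)
      (chartInvDerivC x₀ y v) (chartInvDerivC x₀ y w) := by
  rw [← chartInvDerivR_apply x₀ hy, ← chartInvDerivR_apply x₀ hy]
  rfl

theorem localMatrix_eq (g : HermitianMetric n M) (x₀ : M) {y : Cn n}
    (hy : y ∈ (chartAt (Cn n) x₀).target) :
    g.localMatrix x₀ y = hermMatrix (g.chartMetric x₀ y) := by
  ext i j
  rw [hermMatrix_of_invariant]
  · rfl
  · intro v w
    rw [g.chartMetric_eq_inner x₀ hy, g.chartMetric_eq_inner x₀ hy,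
      map_smul (chartInvDerivC x₀ y), map_smul (chartInvDerivC x₀ y), innerCn_I_smul]

theorem localMatrix_posDef (g : HermitianMetric n M) (x₀ : M) {y : Cn n}
    (hy : y ∈ (chartAt (Cn n) x₀).target) : (g.localMatrix x₀ y).PosDef := by
  rw [g.localMatrix_eq x₀ hy]
  refine hermMatrix_posDef (fun v w => g.innerCn_symm _ _ _) fun v hv =>
    g.innerCn_pos _ _ fun h => hv ?_
  exact chartInvDeriv_injective x₀ hy (h.trans (map_zero _).symm)

theorem localMatrix_self (g : HermitianMetric n M) (x : M) :
    g.localMatrix x (chartAt (Cn n) x x) = hermMatrix (g.innerCn x) := by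
  rw [g.localMatrix_eq x (mem_chart_target _ x)]
  congr 1
  ext v w
  rw [g.chartMetric_eq_inner x (mem_chart_target _ x), chartInvDerivC_self,
    (chartAt (Cn n) x).left_inv (mem_chart_source (Cn n) x)]
  rfl

theorem localMatrix_change (g : HermitianMetric n M) (x₀ : M) {y : Cn n}
    (hy : y ∈ (chartAt (Cn n) x₀).target) :
    g.localMatrix x₀ y = rowMatrix (chartInvDerivC x₀ y) *
      hermMatrix (g.innerCn ((chartAt (Cn n) x₀).symm y)) *
        (rowMatrix (chartInvDerivC x₀ y)).conjTranspose := by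
  rw [g.localMatrix_eq x₀ hy]
  exact hermMatrix_comp _ _ _ (g.chartMetric_eq_inner x₀ hy)

theorem hermMatrix_innerCn_posDef (g : HermitianMetric n M) (x : M) :
    (hermMatrix (g.innerCn x)).PosDef := by
  rw [← g.localMatrix_self]
  exact g.localMatrix_posDef x (mem_chart_target _ x)

/-- `log det` of the metric at a point. -/
def logDet (g : HermitianMetric n M) (x : M) : ℝ := Real.log (hermMatrix (g.innerCn x)).det.re

/-- `log det` of the metric in a chart. -/
def localLogDet (g : HermitianMetric n M) (x₀ : M) (y : Cn n) : ℝ :=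
  Real.log (g.localMatrix x₀ y).det.re

/-- Changing coordinates multiplies the determinant by |det|² of the holomorphic Jacobian, a factor
independent of the metric. -/
theorem localLogDet_eq (g : HermitianMetric n M) (x₀ : M) {y : Cn n}
    (hy : y ∈ (chartAt (Cn n) x₀).target) :
    g.localLogDet x₀ y = Real.log (Complex.normSq (rowMatrix (chartInvDerivC x₀ y)).det) +
      g.logDet ((chartAt (Cn n) x₀).symm y) := by
  obtain ⟨e1, p1⟩ := det_eq_ofReal_re (g.localMatrix_posDef x₀ hy)
  obtain ⟨e2, p2⟩ := det_eq_ofReal_re (g.hermMatrix_innerCn_posDef ((chartAt (Cn n) x₀).symm y))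
  have h : (g.localMatrix x₀ y).det.re = Complex.normSq (rowMatrix (chartInvDerivC x₀ y)).det *
      (hermMatrix (g.innerCn ((chartAt (Cn n) x₀).symm y))).det.re := by
    have h1 := congrArg Matrix.det (g.localMatrix_change x₀ hy)
    rw [Matrix.det_mul, Matrix.det_mul, Matrix.det_conjTranspose, e1, e2, mul_right_comm,
      Complex.star_def, Complex.mul_conj] at h1
    exact_mod_cast h1
  rw [localLogDet, logDet, h, Real.log_mul _ p2.ne']
  rintro h0
  rw [h0, zero_mul] at h
  exact p1.ne' h

theorem localLogDet_sub (g g' : HermitianMetric n M) (x₀ : M) {y : Cn n}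
    (hy : y ∈ (chartAt (Cn n) x₀).target) :
    g'.localLogDet x₀ y - g.localLogDet x₀ y =
      g'.logDet ((chartAt (Cn n) x₀).symm y) - g.logDet ((chartAt (Cn n) x₀).symm y) := by
  rw [g.localLogDet_eq x₀ hy, g'.localLogDet_eq x₀ hy]
  ring

/-- The matrix of `chartInvDeriv x₀ y` can jump with the preferred chart at the image point, so
smoothness is argued in the tangent bundle: constant fields are pushed forward by the tangent map
and inserted into the smooth section g. -/
theorem contDiffOn_chartMetric (g : HermitianMetric n M) (x₀ : M) (v w : Cn n) :
    ContDiffOn ℝ ∞ (fun y => g.chartMetric x₀ y v w) (chartAt (Cn n) x₀).target := by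
  rw [← contMDiffOn_iff_contDiffOn]
  intro y hy
  have hU : IsOpen (chartAt (Cn n) x₀).target := (chartAt (Cn n) x₀).open_target
  have hsymm : ContMDiffOn 𝓘(ℝ, Cn n) 𝓘(ℝ, Cn n) ∞ (chartAt (Cn n) x₀).symm
      (chartAt (Cn n) x₀).target := contMDiffOn_chart_symm
  have hT := hsymm.contMDiffOn_tangentMapWithin (m := ∞) (by simp) hU.uniqueMDiffOn
  have hv : ∀ v : Cn n, ContMDiffWithinAt 𝓘(ℝ, Cn n) (𝓘(ℝ, Cn n).prod 𝓘(ℝ, Cn n)) ∞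
      (fun z => Bundle.TotalSpace.mk' (Cn n) (E := fun x : M => TangentSpace 𝓘(ℝ, Cn n) x)
        ((chartAt (Cn n) x₀).symm z) (chartInvDeriv x₀ z v)) (chartAt (Cn n) x₀).target y := by
    intro v
    have hs : ContMDiff 𝓘(ℝ, Cn n) 𝓘(ℝ, Cn n).tangent ∞
        (fun z : Cn n => (⟨z, v⟩ : TangentBundle 𝓘(ℝ, Cn n) (Cn n))) :=
      contMDiff_vectorSpace_iff_contDiff.2 contDiff_const
    have h1 := (ContMDiffOn.comp (t := Bundle.TotalSpace.proj ⁻¹' (chartAt (Cn n) x₀).target) hT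
      (hs.contMDiffOn (s := (chartAt (Cn n) x₀).target)) (fun z hz => hz)) y hy
    have e : ∀ z ∈ (chartAt (Cn n) x₀).target,
        Bundle.TotalSpace.mk' (Cn n) (E := fun x : M => TangentSpace 𝓘(ℝ, Cn n) x)
          ((chartAt (Cn n) x₀).symm z) (chartInvDeriv x₀ z v) =
        tangentMapWithin 𝓘(ℝ, Cn n) 𝓘(ℝ, Cn n) (chartAt (Cn n) x₀).symm
          (chartAt (Cn n) x₀).target ⟨z, v⟩ := by
      intro z hz
      rw [tangentMapWithin, mfderivWithin_of_mem_nhds (hU.mem_nhds hz)]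
      rfl
    exact h1.congr e (e y hy)
  have hb : ContMDiffWithinAt 𝓘(ℝ, Cn n) 𝓘(ℝ, Cn n) ∞ (chartAt (Cn n) x₀).symm
      (chartAt (Cn n) x₀).target y := hsymm y hy
  have : ContMDiffWithinAt 𝓘(ℝ, Cn n) (𝓘(ℝ, Cn n).prod 𝓘(ℝ)) ∞
      (fun m ↦ Bundle.TotalSpace.mk' ℝ (E := Bundle.Trivial M ℝ) ((chartAt (Cn n) x₀).symm m)
        (g.inner ((chartAt (Cn n) x₀).symm m) (chartInvDeriv x₀ m v) (chartInvDeriv x₀ m w)))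
      (chartAt (Cn n) x₀).target y := by
    apply ContMDiffWithinAt.clm_bundle_apply₂ (F₁ := Cn n) (F₂ := Cn n)
    · exact ContMDiffAt.comp_contMDiffWithinAt y g.contMDiff.contMDiffAt hb
    · exact hv v
    · exact hv w
  simp only [Bundle.contMDiffWithinAt_totalSpace] at this
  exact this.2

theorem contDiffOn_localLogDet (g : HermitianMetric n M) (x₀ : M) :
    ContDiffOn ℝ ∞ (g.localLogDet x₀) (chartAt (Cn n) x₀).target := by
  have hent : ∀ i j, ContDiffOn ℝ ∞ (fun y => g.localMatrix x₀ y i j)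
      (chartAt (Cn n) x₀).target := by
    intro i j
    refine ContDiffOn.congr (f := fun y => hermMatrix (g.chartMetric x₀ y) i j) ?_
      (fun y hy => by rw [g.localMatrix_eq x₀ hy])
    simp only [hermMatrix, sesqForm_apply]
    refine contDiffOn_const.mul (ContDiffOn.add ?_ (contDiffOn_const.mul ?_))
    · exact Complex.ofRealCLM.contDiff.comp_contDiffOn
        ((g.contDiffOn_chartMetric x₀ _ _).add (g.contDiffOn_chartMetric x₀ _ _))
    · exact Complex.ofRealCLM.contDiff.comp_contDiffOn
        ((g.contDiffOn_chartMetric x₀ _ _).sub (g.contDiffOn_chartMetric x₀ _ _))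
  refine ContDiffOn.log ?_ fun y hy => (det_eq_ofReal_re (g.localMatrix_posDef x₀ hy)).2.ne'
  refine Complex.reCLM.contDiff.comp_contDiffOn ?_
  simp only [Matrix.det_apply]
  exact ContDiffOn.sum fun σ _ => (contDiffOn_prod fun i _ => hent _ _).const_smul _

end HermitianMetric

end Charts

/-! ### The operators `∂` and `∂̄` on functions -/

section LocalOperators

variable {n : ℕ}

/-- Taking coordinates is linear, so the auxiliary basis in `dirDeriv` drops out. -/
theorem dirDeriv_sum_smul {ι : Type*} [Fintype ι] {c : ι → Cn n → ℂ} (ψ : ι → Form n) {y : Cn n}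
    (hc : ∀ i, DifferentiableAt ℝ (c i) y) (v : Cn n) :
    dirDeriv (fun z => ∑ i, c i z • ψ i) y v = ∑ i, fderiv ℝ (c i) y v • ψ i := by
  have h : ∀ k, fderiv ℝ (fun z => (formBasis n).repr (∑ i, c i z • ψ i) k) y v =
      ∑ i, fderiv ℝ (c i) y v * (formBasis n).repr (ψ i) k := by
    intro k
    have e : (fun z => (formBasis n).repr (∑ i, c i z • ψ i) k) =
        fun z => ∑ i, c i z * (formBasis n).repr (ψ i) k := by
      funext z
      simp [Finsupp.finsetSum_apply]
    rw [e, fderiv_fun_sum fun i _ => (hc i).mul_const _, sum_apply]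
    refine Finset.sum_congr rfl fun i _ => ?_
    rw [fderiv_mul_const (hc i)]
    simp [mul_comm]
  rw [dirDeriv]
  simp only [h, Finset.sum_smul, mul_smul]
  rw [Finset.sum_comm]
  refine Finset.sum_congr rfl fun i _ => ?_
  rw [← Finset.smul_sum, (formBasis n).sum_repr]

theorem dirDeriv_congr {F G : Cn n → Form n} {y : Cn n} (h : F =ᶠ[nhds y] G) (v : Cn n) :
    dirDeriv F y v = dirDeriv G y v := by
  refine Finset.sum_congr rfl fun k _ => ?_
  rw [Filter.EventuallyEq.fderiv_eq (h.mono fun z hz => by rw [hz])]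

theorem delLocal_congr {F G : Cn n → Form n} {y : Cn n} (h : F =ᶠ[nhds y] G) :
    delLocal F y = delLocal G y := by
  simp only [delLocal, partialZ, dirDeriv_congr h]

theorem dirDeriv_zeroForm {h : Cn n → ℝ} {y : Cn n} (hh : DifferentiableAt ℝ h y) (v : Cn n) :
    dirDeriv (fun z => zeroForm (h z : ℂ)) y v = ((fderiv ℝ h y v : ℝ) : ℂ) • (1 : Form n) := by
  have e : (fun z => zeroForm (h z : ℂ)) = fun z => ∑ _i : Unit, (h z : ℂ) • (1 : Form n) := by
    funext z
    simp [zeroForm, Algebra.algebraMap_eq_smul_one]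
  have hd : DifferentiableAt ℝ (fun z => (h z : ℂ)) y :=
    Complex.ofRealCLM.differentiableAt.comp y hh
  rw [e, dirDeriv_sum_smul (fun _ => 1) (fun _ => hd)]
  have : fderiv ℝ (fun z => (h z : ℂ)) y = Complex.ofRealCLM.comp (fderiv ℝ h y) :=
    (Complex.ofRealCLM.hasFDerivAt.comp y hh.hasFDerivAt).fderiv
  simp [this]

theorem delLocal_zeroForm_eq {h h' : Cn n → ℝ} {y : Cn n} (hh : DifferentiableAt ℝ h y)
    (hh' : DifferentiableAt ℝ h' y) (e : fderiv ℝ h y = fderiv ℝ h' y) :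
    delLocal (fun z => zeroForm (h z : ℂ)) y = delLocal (fun z => zeroForm (h' z : ℂ)) y := by
  simp only [delLocal, partialZ, dirDeriv_zeroForm hh, dirDeriv_zeroForm hh', e]

/-- `∂h/∂z̄ⁱ` for a real function `h`. -/
def dbar (h : Cn n → ℝ) (i : Fin n) (y : Cn n) : ℂ :=
  (1 / 2 : ℂ) * ((fderiv ℝ h y (stdVec i) : ℝ) +
    Complex.I * (fderiv ℝ h y (Complex.I • stdVec i) : ℝ))

theorem delbarLocal_zeroForm {h : Cn n → ℝ} {y : Cn n} (hh : DifferentiableAt ℝ h y) :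
    delbarLocal (fun z => zeroForm (h z : ℂ)) y = ∑ i, dbar h i y • oneForm (dzbar i) := by
  refine Finset.sum_congr rfl fun i _ => ?_
  rw [partialZbar, dirDeriv_zeroForm hh, dirDeriv_zeroForm hh, smul_smul, ← add_smul, smul_smul,
    mul_smul_comm, mul_one, dbar]

theorem fderiv_dbar {h : Cn n → ℝ} {y : Cn n} (hh : ContDiffAt ℝ 2 h y) (i : Fin n) :
    DifferentiableAt ℝ (dbar h i) y ∧ ∀ v, fderiv ℝ (dbar h i) y v =
      (1 / 2 : ℂ) * ((fderiv ℝ (fderiv ℝ h) y v (stdVec i) : ℝ) +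
        Complex.I * (fderiv ℝ (fderiv ℝ h) y v (Complex.I • stdVec i) : ℝ)) := by
  have h1 : DifferentiableAt ℝ (fderiv ℝ h) y :=
    (hh.fderiv_right (m := 1) (by norm_num)).differentiableAt (by norm_num)
  have h2 : ∀ w : Cn n, HasFDerivAt (fun z => ((fderiv ℝ h z w : ℝ) : ℂ))
      (Complex.ofRealCLM.comp ((fderiv ℝ (fderiv ℝ h) y).flip w)) y := fun w =>
    Complex.ofRealCLM.hasFDerivAt.comp y (h1.hasFDerivAt.clm_apply (hasFDerivAt_const w y)
      |>.congr_fderiv (by ext; simp))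
  have h3 := ((h2 (stdVec i)).add ((h2 (Complex.I • stdVec i)).const_mul Complex.I)).const_mul
    (1 / 2 : ℂ)
  refine ⟨h3.differentiableAt, fun v => ?_⟩
  have h4 := h3.fderiv
  change fderiv ℝ (dbar h i) y = _ at h4
  rw [h4]
  simp [mul_add]

/-- Expanding ∂²h/∂zⁱ∂z̄ʲ in real second derivatives gives exactly the combination in `sesqForm`,
with factor 1/4. -/
theorem I_smul_delLocal_delbarLocal {h : Cn n → ℝ} {y : Cn n} (hh : ContDiffAt ℝ 2 h y) :
    Complex.I • delLocal (delbarLocal fun z => zeroForm (h z : ℂ)) y =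
      (matForm (hermMatrix (fderiv ℝ (fderiv ℝ h) y)) : Form n) := by
  have e : (delbarLocal fun z => zeroForm (h z : ℂ)) =ᶠ[nhds y]
      fun z => ∑ i, dbar h i z • oneForm (dzbar i) := by
    filter_upwards [hh.eventually (by simp)] with z hz
    exact delbarLocal_zeroForm (hz.differentiableAt (by norm_num))
  rw [delLocal_congr e, coe_matForm, delLocal]
  congr 1
  refine Finset.sum_congr rfl fun i _ => ?_
  rw [partialZ, dirDeriv_sum_smul _ (fun j => (fderiv_dbar hh j).1),
    dirDeriv_sum_smul _ (fun j => (fderiv_dbar hh j).1), Finset.smul_sum, ← Finset.sum_sub_distrib,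
    Finset.smul_sum, Finset.mul_sum]
  refine Finset.sum_congr rfl fun j _ => ?_
  rw [smul_smul, ← sub_smul, smul_smul, mul_smul_comm]
  congr 1
  rw [(fderiv_dbar hh j).2, (fderiv_dbar hh j).2, hermMatrix, sesqForm_apply]
  push_cast
  linear_combination (-(1 / 4) * (fderiv ℝ (fderiv ℝ h) y (Complex.I • stdVec i)
    (Complex.I • stdVec j) : ℂ)) * Complex.I_sq

/-- At a local maximum the second derivative is nonpositive. -/
theorem fderiv_fderiv_nonpos_of_isLocalMax {u : Cn n → ℝ} {y : Cn n} (hu : ContDiffAt ℝ 2 u y)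
    (hmax : IsLocalMax u y) (v : Cn n) : fderiv ℝ (fderiv ℝ u) y v v ≤ 0 := by
  by_contra! hpos
  set φ : ℝ → ℝ := fun t => u (y + t • v) with hφ
  have hline : ∀ t : ℝ, HasDerivAt (fun t : ℝ => y + t • v) v t := fun t => by
    simpa using ((hasDerivAt_id t).smul_const v).const_add y
  have htend : Filter.Tendsto (fun t : ℝ => y + t • v) (nhds 0) (nhds y) := by
    have := (hline 0).continuousAt.tendsto
    simpa using this
  have hd : ∀ᶠ t in nhds (0 : ℝ), HasDerivAt φ (fderiv ℝ u (y + t • v) v) t := by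
    filter_upwards [htend.eventually (hu.eventually (by simp))] with t ht
    exact ((ht.differentiableAt (by norm_num)).hasFDerivAt).comp_hasDerivAt t (hline t)
  have h1 : DifferentiableAt ℝ (fderiv ℝ u) y :=
    (hu.fderiv_right (m := 1) (by norm_num)).differentiableAt (by norm_num)
  have hderiv : deriv φ =ᶠ[nhds 0] fun t => fderiv ℝ u (y + t • v) v :=
    hd.mono fun t ht => ht.deriv
  have h2 : HasDerivAt (deriv φ) (fderiv ℝ (fderiv ℝ u) y v v) 0 := by
    refine HasDerivAt.congr_of_eventuallyEq ?_ hderiv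
    have h3 : HasFDerivAt (fderiv ℝ u) (fderiv ℝ (fderiv ℝ u) y) (y + (0 : ℝ) • v) := by
      simpa using h1.hasFDerivAt
    have h4 := h3.comp_hasDerivAt (0 : ℝ) (hline 0)
    simpa using h4.clm_apply (hasDerivAt_const (0 : ℝ) v)
  have hmax' : IsLocalMax φ 0 := by
    have h5 : ∀ᶠ z in nhds y, u z ≤ u y := hmax
    filter_upwards [htend.eventually h5] with t ht
    simpa [hφ] using ht
  -- A positive second derivative would make 0 a local minimum as well; φ would then be constant
  -- near 0, contradicting that positivity.
  have hmin : IsLocalMin φ 0 := isLocalMin_of_deriv_deriv_pos (by rwa [h2.deriv])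
    hmax'.deriv_eq_zero hd.self_of_nhds.continuousAt
  have hconst : φ =ᶠ[nhds 0] fun _ => φ 0 := by
    filter_upwards [hmax', hmin] with t h5 h6 using le_antisymm h5 h6
  have h7 : deriv φ =ᶠ[nhds 0] fun _ => 0 := by
    have := hconst.deriv
    simpa using this
  have h8 := h7.deriv_eq
  rw [h2.deriv] at h8
  simp at h8
  exact hpos.ne' h8

theorem hermMatrix_sub (B B' : Cn n →L[ℝ] Cn n →L[ℝ] ℝ) :
    hermMatrix (B - B') = hermMatrix B - hermMatrix B' := by
  ext i j
  simp only [hermMatrix, sesqForm_apply, Matrix.sub_apply, sub_apply]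
  push_cast
  ring

theorem matForm_sub (G G' : Matrix (Fin n) (Fin n) ℂ) :
    matForm (G - G') = matForm G - matForm G' := by
  simp [matForm, sub_smul, Finset.sum_sub_distrib]

end LocalOperators

/-! ### The continuity equation -/

section Equation

variable {n : ℕ} {M : Type*} [TopologicalSpace M] [ChartedSpace (Cn n) M]

theorem inChart_funForm (f : M → ℝ) (x₀ : M) :
    inChart (funForm (n := n) f) x₀ =
      fun y => zeroForm ((f ((chartAt (Cn n) x₀).symm y) : ℝ) : ℂ) := by
  funext y
  exact AlgHom.commutes _ _

variable [IsManifold 𝓘(ℂ, Cn n) ω M]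

namespace HermitianMetric

theorem form_eq (g : HermitianMetric n M) (x : M) :
    g.form x = (matForm (hermMatrix (g.innerCn x)) : Form n) := by
  rw [form, localMatrix_self, coe_matForm]

theorem logRatio_eq (g α : HermitianMetric n M) (x : M) :
    g.logRatio α x = g.logDet x - α.logDet x := by
  have hg := g.hermMatrix_innerCn_posDef x
  have hα := α.hermMatrix_innerCn_posDef x
  rw [logRatio, form_eq, form_eq, topRatio_matForm hg hα,
    Real.log_div (det_eq_ofReal_re hg).2.ne' (det_eq_ofReal_re hα).2.ne']
  rfl

theorem contDiffAt_localLogDet (g : HermitianMetric n M) (x : M) :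
    ContDiffAt ℝ 2 (g.localLogDet x) (chartAt (Cn n) x x) :=
  ((g.contDiffOn_localLogDet x).contDiffAt
    ((chartAt (Cn n) x).open_target.mem_nhds (mem_chart_target _ x))).of_le (WithTop.coe_le_coe.2 (le_top : (2 : ℕ∞) ≤ ⊤))

theorem chernRicci_eq (g : HermitianMetric n M) (x : M) :
    g.chernRicci x = -(matForm (hermMatrix
      (fderiv ℝ (fderiv ℝ (g.localLogDet x)) (chartAt (Cn n) x x))) : Form n) := by
  rw [← I_smul_delLocal_delbarLocal (g.contDiffAt_localLogDet x)]
  rfl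

/-- The difference of the two sides of the continuity equation for two metrics whose volume ratio
is critical at `x`. -/
theorem form_pow_sub_form_pow {ω₀ α g g' : HermitianMetric n M} {s : ℝ}
    (hg : SolvesContinuityEquation ω₀ α g s) (hg' : SolvesContinuityEquation ω₀ α g' s) (x : M)
    (hcrit : fderiv ℝ (g'.localLogDet x) (chartAt (Cn n) x x) =
      fderiv ℝ (g.localLogDet x) (chartAt (Cn n) x x)) :
    matForm (hermMatrix (g.innerCn x)) ^ (n - 1) - matForm (hermMatrix (g'.innerCn x)) ^ (n - 1) =
      matForm (((s * ((n : ℝ) - 1) : ℝ) : ℂ) • hermMatrix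
        (fderiv ℝ (fderiv ℝ (g.localLogDet x)) (chartAt (Cn n) x x) -
          fderiv ℝ (fderiv ℝ (g'.localLogDet x)) (chartAt (Cn n) x x))) *
        matForm (hermMatrix (α.innerCn x)) ^ (n - 2) := by
  have hd : ∀ h : HermitianMetric n M,
      DifferentiableAt ℝ (h.localLogDet x) (chartAt (Cn n) x x) := fun h =>
    (h.contDiffAt_localLogDet x).differentiableAt (by norm_num)
  have hloc : ∀ h : HermitianMetric n M, del (funForm (n := n) (h.logRatio α)) x =
      delLocal (fun z => zeroForm ((h.localLogDet x z - α.localLogDet x z : ℝ) : ℂ))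
        (chartAt (Cn n) x x) := by
    intro h
    rw [del, inChart_funForm]
    apply delLocal_congr
    filter_upwards [(chartAt (Cn n) x).open_target.mem_nhds (mem_chart_target (Cn n) x)] with z hz
    rw [logRatio_eq, localLogDet_sub α h x hz]
  -- ∂ sees only first derivatives, which agree at x, so the terms with ∂̄(αⁿ⁻²) cancel below.
  have hdel : del (funForm (n := n) (g'.logRatio α)) x = del (funForm (n := n) (g.logRatio α)) x := by
    rw [hloc, hloc]
    refine delLocal_zeroForm_eq ((hd g').sub (hd α)) ((hd g).sub (hd α)) ?_
    rw [fderiv_fun_sub (hd g') (hd α), fderiv_fun_sub (hd g) (hd α), hcrit]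
  have h1 := (hg x).1
  have h2 := (hg' x).1
  rw [continuityForm] at h1 h2
  rw [hdel] at h2
  have h3 : g.form x ^ (n - 1) - g'.form x ^ (n - 1) = ((s * ((n : ℝ) - 1) : ℝ) : ℂ) •
      ((g'.chernRicci x - g.chernRicci x) * α.form x ^ (n - 2)) := by
    rw [h1, h2, sub_sub_sub_cancel_left, ← smul_sub, sub_sub_sub_cancel_right, sub_mul]
  rw [chernRicci_eq, chernRicci_eq, form_eq, form_eq, form_eq, neg_sub_neg] at h3
  rw [hermMatrix_sub, matForm_smul, matForm_sub]
  apply Subtype.ext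
  rw [smul_mul_assoc]
  exact h3

theorem isLocalMax_localLogDet_sub {g g' : HermitianMetric n M} {x : M}
    (hx : ∀ x', g'.logDet x' - g.logDet x' ≤ g'.logDet x - g.logDet x) :
    IsLocalMax (fun z => g'.localLogDet x z - g.localLogDet x z) (chartAt (Cn n) x x) := by
  filter_upwards [(chartAt (Cn n) x).open_target.mem_nhds (mem_chart_target (Cn n) x)] with z hz
  rw [localLogDet_sub g g' x hz, localLogDet_sub g g' x (mem_chart_target _ x),
    (chartAt (Cn n) x).left_inv (mem_chart_source (Cn n) x)]
  exact hx _

/-- Each `logDet` is read in the preferred chart at the point and need not be continuous; in the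
difference the Jacobian factors cancel. -/
theorem continuous_logDet_sub (g g' : HermitianMetric n M) :
    Continuous fun x => g'.logDet x - g.logDet x := by
  rw [continuous_iff_continuousAt]
  intro x
  have h1 : ContinuousAt (fun z => g'.localLogDet x z - g.localLogDet x z) (chartAt (Cn n) x x) :=
    (g'.contDiffAt_localLogDet x).continuousAt.sub (g.contDiffAt_localLogDet x).continuousAt
  have h2 := ContinuousAt.comp (f := chartAt (Cn n) x) h1
    ((chartAt (Cn n) x).continuousAt (mem_chart_source (Cn n) x))
  refine h2.congr ?_
  filter_upwards [(chartAt (Cn n) x).open_source.mem_nhds (mem_chart_source (Cn n) x)] with z hz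
  rw [Function.comp_apply, localLogDet_sub g g' x ((chartAt (Cn n) x).map_source hz),
    (chartAt (Cn n) x).left_inv hz]

/-- The maximum principle for the ratio of the volume forms of two solutions. -/
theorem logDet_le_of_solves (hn : 2 ≤ n) [CompactSpace M] {ω₀ α g g' : HermitianMetric n M} {s : ℝ}
    (hs : 0 ≤ s) (hg : SolvesContinuityEquation ω₀ α g s)
    (hg' : SolvesContinuityEquation ω₀ α g' s) (x : M) : g'.logDet x ≤ g.logDet x := by
  obtain ⟨p, -, hp⟩ := isCompact_univ.exists_isMaxOn (⟨x, Set.mem_univ x⟩ : Set.univ.Nonempty)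
    (continuous_logDet_sub g g').continuousOn
  have hp' : ∀ x', g'.logDet x' - g.logDet x' ≤ g'.logDet p - g.logDet p := fun x' =>
    hp (Set.mem_univ x')
  have hmax := isLocalMax_localLogDet_sub hp'
  have hd : ∀ h : HermitianMetric n M,
      DifferentiableAt ℝ (h.localLogDet p) (chartAt (Cn n) p p) := fun h =>
    (h.contDiffAt_localLogDet p).differentiableAt (by norm_num)
  have hcrit : fderiv ℝ (g'.localLogDet p) (chartAt (Cn n) p p) =
      fderiv ℝ (g.localLogDet p) (chartAt (Cn n) p p) := by
    rw [← sub_eq_zero, ← fderiv_fun_sub (hd g') (hd g)]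
    exact hmax.fderiv_eq_zero
  have heq := form_pow_sub_form_pow hg hg' p hcrit
  have hC2 : ContDiffAt ℝ 2 (fun z => g'.localLogDet p z - g.localLogDet p z) (chartAt (Cn n) p p) :=
    (g'.contDiffAt_localLogDet p).sub (g.contDiffAt_localLogDet p)
  have hsecond : fderiv ℝ (fderiv ℝ fun z => g'.localLogDet p z - g.localLogDet p z)
      (chartAt (Cn n) p p) = fderiv ℝ (fderiv ℝ (g'.localLogDet p)) (chartAt (Cn n) p p) -
        fderiv ℝ (fderiv ℝ (g.localLogDet p)) (chartAt (Cn n) p p) := by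
    have e : (fderiv ℝ fun z => g'.localLogDet p z - g.localLogDet p z) =ᶠ[nhds (chartAt (Cn n) p p)]
        fun z => fderiv ℝ (g'.localLogDet p) z - fderiv ℝ (g.localLogDet p) z := by
      filter_upwards [(g'.contDiffAt_localLogDet p).eventually (by simp),
        (g.contDiffAt_localLogDet p).eventually (by simp)] with z h1 h2
      exact fderiv_fun_sub (h1.differentiableAt (by norm_num)) (h2.differentiableAt (by norm_num))
    rw [e.fderiv_eq, fderiv_fun_sub]
    · exact ((g'.contDiffAt_localLogDet p).fderiv_right (m := 1) (by norm_num)).differentiableAt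
        (by norm_num)
    · exact ((g.contDiffAt_localLogDet p).fderiv_right (m := 1) (by norm_num)).differentiableAt
        (by norm_num)
  -- Minus the Hessian of log det g' - log det g, which is nonpositive at the maximum p.
  have hpsd : (hermMatrix (fderiv ℝ (fderiv ℝ (g.localLogDet p)) (chartAt (Cn n) p p) -
      fderiv ℝ (fderiv ℝ (g'.localLogDet p)) (chartAt (Cn n) p p))).PosSemidef := by
    have hsymm : ∀ h : HermitianMetric n M, ∀ v w,
        fderiv ℝ (fderiv ℝ (h.localLogDet p)) (chartAt (Cn n) p p) v w =
          fderiv ℝ (fderiv ℝ (h.localLogDet p)) (chartAt (Cn n) p p) w v := fun h =>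
      ((h.contDiffAt_localLogDet p).isSymmSndFDerivAt (by simp)).eq
    refine hermMatrix_posSemidef (fun v w => ?_) fun v => ?_
    · simp only [sub_apply]
      rw [hsymm g v w, hsymm g' v w]
    · have := fderiv_fderiv_nonpos_of_isLocalMax hC2 hmax v
      rw [hsecond] at this
      simp only [sub_apply] at this ⊢
      linarith
  have hc : (0 : ℝ) ≤ s * ((n : ℝ) - 1) :=
    mul_nonneg hs (sub_nonneg.2 (by exact_mod_cast (by omega : 1 ≤ n)))
  have hdet := det_le_of_pow_sub_pow_eq hn (g.hermMatrix_innerCn_posDef p)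
    (g'.hermMatrix_innerCn_posDef p) (hpsd.smul (by exact_mod_cast hc))
    (α.hermMatrix_innerCn_posDef p).posSemidef heq
  -- The maximum of the difference is thus at most 0, which bounds it at every x.
  have hlog : g'.logDet p ≤ g.logDet p :=
    Real.log_le_log (det_eq_ofReal_re (g'.hermMatrix_innerCn_posDef p)).2 hdet
  have := hp' x
  linarith

theorem eq_of_innerCn_eq {g g' : HermitianMetric n M} (h : ∀ x, g.innerCn x = g'.innerCn x) :
    g = g' := by
  have h1 : g.inner = g'.inner := funext h
  obtain ⟨⟨i, _, _, _, _⟩, _⟩ := g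
  obtain ⟨⟨i', _, _, _, _⟩, _⟩ := g'
  obtain rfl : i = i' := h1
  rfl

/-- Solutions of the continuity equation at `s ≥ 0` are unique. -/
theorem eq_of_solves (hn : 2 ≤ n) [CompactSpace M] {ω₀ α g g' : HermitianMetric n M} {s : ℝ}
    (hs : 0 ≤ s) (hg : SolvesContinuityEquation ω₀ α g s)
    (hg' : SolvesContinuityEquation ω₀ α g' s) : g' = g := by
  have hlog : ∀ x, g'.logDet x = g.logDet x := fun x =>
    le_antisymm (logDet_le_of_solves hn hs hg hg' x) (logDet_le_of_solves hn hs hg' hg x)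
  refine eq_of_innerCn_eq fun x => ?_
  -- The volume forms agree everywhere, so every point is critical and the second-order term
  -- vanishes too.
  have hloc : g'.localLogDet x =ᶠ[nhds (chartAt (Cn n) x x)] g.localLogDet x := by
    filter_upwards [(chartAt (Cn n) x).open_target.mem_nhds (mem_chart_target (Cn n) x)] with z hz
    have := localLogDet_sub g g' x hz
    rwa [hlog, sub_self, sub_eq_zero] at this
  have heq := form_pow_sub_form_pow hg hg' x hloc.fderiv_eq
  have h0 : matForm (0 : Matrix (Fin n) (Fin n) ℂ) = 0 := by simp [matForm]
  rw [hloc.fderiv.fderiv_eq, hermMatrix_sub, sub_self, smul_zero, h0, zero_mul] at heq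
  have hmat := eq_of_matForm_pow_eq hn (g.hermMatrix_innerCn_posDef x)
    (g'.hermMatrix_innerCn_posDef x) (sub_eq_zero.1 heq)
  exact eq_of_hermMatrix_eq (g'.innerCn_I_smul x) (g.innerCn_I_smul x) hmat.symm

end HermitianMetric

end Equation

end GauduchonContinuity

end

theorem corollary3p2 {n : ℕ} (hn : 2 ≤ n) {M : Type*} [TopologicalSpace M]
    [ChartedSpace (Cn n) M] [IsManifold 𝓘(ℂ, Cn n) ω M] [CompactSpace M] [T2Space M]
    (ω₀ α : HermitianMetric n M) (hα : α.IsGauduchon)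
    (s : ℝ) (hs₀ : 0 ≤ s) (hsT : (s : EReal) < HermitianMetric.maximalTime ω₀ α)
    (g g' : HermitianMetric n M)
    (hg : HermitianMetric.SolvesContinuityEquation ω₀ α g s)
    (hg' : HermitianMetric.SolvesContinuityEquation ω₀ α g' s) :
    g' = g :=
  HermitianMetric.eq_of_solves hn hs₀ hg hg'
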